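/- **Lemma.** Let $S$ be a compact smooth surface, possibly with boundary, and let $j_n$ ($n\in\mathbb N$) and $j$ be complex structures on $S$, that is, smooth fields of endomorphisms of $TS$ with $j_n^2=-\mathrm{id}$ and $j^2=-\mathrm{id}$. Assume that $j_n\to j$ in $C^\infty(S)$, that is, in the charts of $S$ the coordinate representations of $j_n$ converge to that of $j$ together with all derivatives, uniformly on compact subsets of the chart image (up to the boundary of $S$). Let $D=\{w\in\mathbb C:|w|<1\}$ with its standard complex structure $i$. Then for each interior point $z\in\operatorname{int}(S)$ there exist open neighbourhoods $U_n$ ($n\in\mathbb N$) and $U$ of $z$ in $S$ and diffeomorphisms $$\psi_n:D\to U_n,\qquad \psi:D\to U$$ such that 1. each $\psi_n$ is an $i$-$j_n$-biholomorphism ($d\psi_n\circ i=j_n\circ d\psi_n$), and $\psi$ is an $i$-$j$-biholomorphism ($d\psi\circ i=j\circ d\psi$); 2. $\psi_n\to\psi$ in $C^\infty_{\mathrm{loc}}(D)$ as $n\to\infty$: whenever $K\subset D$ is compact and $\psi(K)$ lies in the domain of a chart $\varphi$ of $S$, then $\psi_n(K)$ lies in the domain of $\varphi$ for all large $n$, and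 all derivatives (of order $\ge 0$) of $\varphi\circ\psi_n$ converge to those of $\varphi\circ\psi$ uniformly on $K$. (This notion is the same as convergence with respect to the Euclidean metric on $D$ and any fixed smooth Riemannian metric on $S$.) 3. $\psi_n(0)=z$ for every $n$, and $\psi(0)=z$. -/

import Mathlib

open Set Filter Topology
open scoped Manifold ContDiff Bundle

/-- The model vector space of a surface. -/
abbrev Plane : Type := EuclideanSpace ℝ (Fin 2)

section Surface

variable (S : Type*) [TopologicalSpace S] [ChartedSpace (EuclideanHalfSpace 2) S]
  [IsManifold (𝓡∂ 2) ∞ S]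

/-- A complex structure on a smooth surface `S`, possibly with boundary: a smooth field of
endomorphisms `j` of the tangent bundle `TS` with `j ∘ j = -id`. Smoothness is smoothness (up to
the boundary) of `j` as a section of the bundle `Hom(TS, TS)`. -/
structure SurfaceComplexStructure where
  /-- the endomorphism of the tangent space at each point -/
  toFun : ∀ x : S, TangentSpace (𝓡∂ 2) x →L[ℝ] TangentSpace (𝓡∂ 2) x
  apply_apply : ∀ (x : S) (v : TangentSpace (𝓡∂ 2) x), toFun x (toFun x v) = -v
  smooth : ContMDiff (𝓡∂ 2) ((𝓡∂ 2).prod 𝓘(ℝ, Plane →L[ℝ] Plane)) ∞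
    (fun x ↦ Bundle.TotalSpace.mk' (Plane →L[ℝ] Plane)
      (E := fun x : S ↦ (TangentSpace (𝓡∂ 2) x →L[ℝ] TangentSpace (𝓡∂ 2) x)) x (toFun x))

variable {S}

/-- The coordinate representation of `j` in the chart `φ` of `S` around `x₀`: the matrix-valued
function `y ↦ dφ ∘ j ∘ (dφ)⁻¹` at the point `φ⁻¹ y`, meaningful for `y` in the image of `φ`. -/
noncomputable def SurfaceComplexStructure.inChart (j : SurfaceComplexStructure S) (x₀ : S)
    (y : Plane) : Plane →L[ℝ] Plane :=
  inTangentCoordinates (𝓡∂ 2) (𝓡∂ 2) id id j.toFun x₀ ((extChartAt (𝓡∂ 2) x₀).symm y)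

/-- `jₙ → j` in `C^∞` on `S` (for compact `S`): in the charts of `S`, the coordinate representations
converge together with their derivatives of every order, uniformly on compact subsets of the image
of the chart (which may touch the boundary of the half-plane). -/
def TendstoSmooth (jn : ℕ → SurfaceComplexStructure S) (j : SurfaceComplexStructure S) : Prop :=
  ∀ (x₀ : S) (K : Set Plane), IsCompact K → K ⊆ (extChartAt (𝓡∂ 2) x₀).target → ∀ m : ℕ,
    TendstoUniformlyOn
      (fun n ↦ iteratedFDerivWithin ℝ m ((jn n).inChart x₀) (extChartAt (𝓡∂ 2) x₀).target)
      (iteratedFDerivWithin ℝ m (j.inChart x₀) (extChartAt (𝓡∂ 2) x₀).target) atTop K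

/-- `ψ` is a biholomorphism from the open unit disk, with its standard complex structure `i`, onto
the open set `ψ.target` of `S` with the complex structure `j`: a diffeomorphism whose
differential satisfies `dψ ∘ i = j ∘ dψ`. -/
structure IsDiskBiholomorphism (j : SurfaceComplexStructure S)
    (ψ : OpenPartialHomeomorph ℂ S) : Prop where
  source_eq : ψ.source = Metric.ball 0 1
  contMDiffOn : ContMDiffOn 𝓘(ℝ, ℂ) (𝓡∂ 2) ∞ ψ ψ.source
  contMDiffOn_symm : ContMDiffOn (𝓡∂ 2) 𝓘(ℝ, ℂ) ∞ ψ.symm ψ.target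
  map_I_mul : ∀ w ∈ ψ.source, ∀ v : ℂ,
    mfderiv 𝓘(ℝ, ℂ) (𝓡∂ 2) ψ w (Complex.I * v : ℂ) =
      j.toFun (ψ w) (mfderiv 𝓘(ℝ, ℂ) (𝓡∂ 2) ψ w v)

end Surface

/-- `Fₙ → F` in `C^∞_loc(Ω)` for maps from an open set `Ω ⊆ ℂ` to a surface `S`: whenever `F` maps a
compact set `K ⊆ Ω` into the domain of a chart `φ` of `S`, so does `Fₙ` for all large `n`, and
`φ ∘ Fₙ → φ ∘ F` uniformly on `K` together with the derivatives of every order. -/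
def TendstoSmoothLoc {S : Type*} [TopologicalSpace S] [ChartedSpace (EuclideanHalfSpace 2) S]
    (Fn : ℕ → ℂ → S) (F : ℂ → S) (Ω : Set ℂ) : Prop :=
  ∀ (x₀ : S) (K : Set ℂ), IsCompact K → K ⊆ Ω → MapsTo F K (extChartAt (𝓡∂ 2) x₀).source →
    (∀ᶠ n in atTop, MapsTo (Fn n) K (extChartAt (𝓡∂ 2) x₀).source) ∧
    ∀ m : ℕ, TendstoUniformlyOn
      (fun n ↦ iteratedFDerivWithin ℝ m (extChartAt (𝓡∂ 2) x₀ ∘ Fn n) Ω)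
      (iteratedFDerivWithin ℝ m (extChartAt (𝓡∂ 2) x₀ ∘ F) Ω) atTop K

/-! This is the existence of isothermal coordinates with smooth dependence on the complex structure.
Since `z` is an interior point, the chart at `z` reduces everything to fields `J` of complex
structures near `0` in `ℂ`, and a linear change of coordinates gives `J₀ 0 = i` for the limit.
Writing `J v = a v + b conj v` with `Im a > 0`, a map `e` with `∂bar e = μ ∂e`, `μ = b / (i - conj
a)`, satisfies `de ∘ J = i de` (`beltramiOf_spec`); the required disk is a rescaled inverse of `e`.

As `μ(0) = 0`, the localized coefficient `χ(x) μ(εx)` is as small as desired for small `ε`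
(`exists_small_cutCoeff`). Its support lies in a fundamental square of the lattice `ℤ[i]`, so the
Beltrami equation can be solved on the torus. With `h = ∂bar e`, it reads `h = μ (1 + S h)`, where
`S = ∂ ∘ ∂bar⁻¹` is the Fourier multiplier `conj k / k`, of modulus at most one. The Neumann series
in the convolution algebra `ℓ¹(ℤ²)` therefore converges once the coefficients of `μ` have small `ℓ¹`
norm; no `L^p` or Hölder estimate is needed. The weights `(1 + η|k|)^s` with small `η` give the same
result with decay of every order, under smallness in `ℓ¹` alone, and continuity in `μ`
(`tendsto_wnorm_neumannSol_sub`).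

The solution has `‖de - id‖ ≤ 1/2`, hence is a global diffeomorphism with 2-Lipschitz inverse, and
inverses converge smoothly when the maps do (`CTendstoAt.symm`). This yields disks for all large
`n`; the remaining ones come from constant sequences. -/

/-! ### Smooth convergence of families of maps, pointwise in the continuous sense. -/

section SmoothConvergence

variable {ι : Type*} {l : Filter ι}
  {E : Type*} [NormedAddCommGroup E] [NormedSpace ℝ E]
  {F : Type*} [NormedAddCommGroup F] [NormedSpace ℝ F]
  {G : Type*} [NormedAddCommGroup G] [NormedSpace ℝ G]

/-- The family `f i` converges to `f₀` near `x` along `l`, together with the derivatives of order at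
most `N`, in the sense of continuous convergence (locally uniform convergence near `x`). -/
structure CTendstoAt (N : ℕ) (l : Filter ι) (f : ι → E → F) (f₀ : E → F) (x : E) : Prop where
  eventually_contDiffAt : ∀ᶠ p : ι × E in l ×ˢ 𝓝 x, ContDiffAt ℝ N (f p.1) p.2
  contDiffAt : ContDiffAt ℝ N f₀ x
  tendsto : ∀ m ≤ N, Tendsto (fun p : ι × E ↦ iteratedFDeriv ℝ m (f p.1) p.2) (l ×ˢ 𝓝 x)
    (𝓝 (iteratedFDeriv ℝ m f₀ x))

theorem tendsto_iteratedFDeriv_zero_iff {f : ι → E → F} {f₀ : E → F} {x : E} :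
    Tendsto (fun p : ι × E ↦ iteratedFDeriv ℝ 0 (f p.1) p.2) (l ×ˢ 𝓝 x)
      (𝓝 (iteratedFDeriv ℝ 0 f₀ x)) ↔
    Tendsto (fun p : ι × E ↦ f p.1 p.2) (l ×ˢ 𝓝 x) (𝓝 (f₀ x)) := by
  simp only [iteratedFDeriv_zero_eq_comp, Function.comp_def]
  exact (continuousMultilinearCurryFin0 ℝ E F).symm.isometry.isEmbedding.tendsto_nhds_iff.symm

theorem CTendstoAt.tendsto_zero {N : ℕ} {f : ι → E → F} {f₀ : E → F} {x : E}
    (h : CTendstoAt N l f f₀ x) :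
    Tendsto (fun p : ι × E ↦ f p.1 p.2) (l ×ˢ 𝓝 x) (𝓝 (f₀ x)) :=
  tendsto_iteratedFDeriv_zero_iff.1 (h.3 0 (Nat.zero_le _))

theorem CTendstoAt.congr {N : ℕ} {f g : ι → E → F} {f₀ g₀ : E → F} {x : E}
    (h : CTendstoAt N l f f₀ x) (hfg : ∀ᶠ p : ι × E in l ×ˢ 𝓝 x, f p.1 =ᶠ[𝓝 p.2] g p.1)
    (h₀ : f₀ =ᶠ[𝓝 x] g₀) : CTendstoAt N l g g₀ x := by
  refine ⟨?_, h.2.congr_of_eventuallyEq h₀.symm, fun m hm ↦ ?_⟩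
  · filter_upwards [h.1, hfg] with p hp hq using hp.congr_of_eventuallyEq hq.symm
  · rw [← (EventuallyEq.iteratedFDeriv ℝ h₀ m).eq_of_nhds]
    refine (h.3 m hm).congr' ?_
    filter_upwards [hfg] with p hp using (EventuallyEq.iteratedFDeriv ℝ hp m).eq_of_nhds

theorem CTendstoAt.const {N : ℕ} {f₀ : E → F} {x : E} (h : ContDiffAt ℝ N f₀ x) :
    CTendstoAt N l (fun _ ↦ f₀) f₀ x := by
  refine ⟨?_, h, fun m hm ↦ ?_⟩
  · exact tendsto_snd.eventually (h.eventually (by simp))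
  · exact (h.continuousAt_iteratedFDeriv (mod_cast hm)).tendsto.comp tendsto_snd

theorem CTendstoAt.of_tendsto {N : ℕ} {c : ι → F} {c₀ : F} (hc : Tendsto c l (𝓝 c₀)) {x : E} :
    CTendstoAt N l (fun i (_ : E) ↦ c i) (fun _ ↦ c₀) x := by
  refine ⟨.of_forall fun _ ↦ contDiffAt_const, contDiffAt_const, fun m hm ↦ ?_⟩
  rcases m with _ | m
  · exact (tendsto_iteratedFDeriv_zero_iff (f := fun i (_ : E) ↦ c i)).2 (hc.comp tendsto_fst)
  · simp [iteratedFDeriv_const_of_ne, tendsto_const_nhds]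

/-- By Faà di Bruno's formula a derivative of the composite is a finite sum of continuous
multilinear expressions in derivatives of the factors of no larger order. -/
theorem CTendstoAt.comp {N : ℕ} {g : ι → F → G} {g₀ : F → G} {f : ι → E → F} {f₀ : E → F} {x : E}
    (hg : CTendstoAt N l g g₀ (f₀ x)) (hf : CTendstoAt N l f f₀ x) :
    CTendstoAt N l (fun i ↦ g i ∘ f i) (g₀ ∘ f₀) x := by
  have hT : Tendsto (fun p : ι × E ↦ (p.1, f p.1 p.2)) (l ×ˢ 𝓝 x) (l ×ˢ 𝓝 (f₀ x)) :=
    tendsto_fst.prodMk hf.tendsto_zero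
  refine ⟨?_, hg.2.comp x hf.2, fun m hm ↦ ?_⟩
  · filter_upwards [hf.1, hT.eventually hg.1] with p h1 h2 using h2.comp _ h1
  · rw [iteratedFDeriv_comp hg.2 hf.2 (mod_cast hm)]
    have : (fun p : ι × E ↦ (ftaylorSeries ℝ (g p.1) (f p.1 p.2)).taylorComp
        (ftaylorSeries ℝ (f p.1) p.2) m) =ᶠ[l ×ˢ 𝓝 x]
        fun p ↦ iteratedFDeriv ℝ m (g p.1 ∘ f p.1) p.2 := by
      filter_upwards [hf.1, hT.eventually hg.1] with p h1 h2
      rw [iteratedFDeriv_comp h2 h1 (mod_cast hm)]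
    refine Tendsto.congr' this ?_
    simp only [FormalMultilinearSeries.taylorComp]
    refine tendsto_finsetSum _ fun c _ ↦ ?_
    simp only [FormalMultilinearSeries.compAlongOrderedFinpartition,
      ← OrderedFinpartition.compAlongOrderedFinpartitionL_apply]
    have h1 : Tendsto (fun p : ι × E ↦ ftaylorSeries ℝ (g p.1) (f p.1 p.2) c.length) (l ×ˢ 𝓝 x)
        (𝓝 (ftaylorSeries ℝ g₀ (f₀ x) c.length)) :=
      (hg.3 _ (c.length_le.trans hm)).comp hT
    have h2 : Tendsto (fun (p : ι × E) i ↦ ftaylorSeries ℝ (f p.1) p.2 (c.partSize i)) (l ×ˢ 𝓝 x)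
        (𝓝 fun i ↦ ftaylorSeries ℝ f₀ x (c.partSize i)) :=
      tendsto_pi_nhds.2 fun i ↦ hf.3 _ ((c.partSize_le i).trans hm)
    have h3 := ((c.compAlongOrderedFinpartitionL ℝ E F G).continuous.tendsto _).comp h1
    exact h3.eval h2

theorem CTendstoAt.comp_left {N : ℕ} {g : F → G} {f : ι → E → F} {f₀ : E → F} {x : E}
    (hg : ContDiffAt ℝ N g (f₀ x)) (hf : CTendstoAt N l f f₀ x) :
    CTendstoAt N l (fun i ↦ g ∘ f i) (g ∘ f₀) x :=
  (CTendstoAt.const hg).comp hf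

theorem CTendstoAt.add {N : ℕ} {f g : ι → E → F} {f₀ g₀ : E → F} {x : E}
    (hf : CTendstoAt N l f f₀ x) (hg : CTendstoAt N l g g₀ x) :
    CTendstoAt N l (fun i y ↦ f i y + g i y) (fun y ↦ f₀ y + g₀ y) x := by
  refine ⟨?_, hf.2.add hg.2, fun m hm ↦ ?_⟩
  · filter_upwards [hf.1, hg.1] with p h1 h2 using h1.add h2
  · have e : iteratedFDeriv ℝ m (fun y ↦ f₀ y + g₀ y) x =
        iteratedFDeriv ℝ m f₀ x + iteratedFDeriv ℝ m g₀ x :=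
      iteratedFDeriv_add_apply (hf.2.of_le (mod_cast hm)) (hg.2.of_le (mod_cast hm))
    rw [e]
    refine ((hf.3 m hm).add (hg.3 m hm)).congr' ?_
    filter_upwards [hf.1, hg.1] with p h1 h2
    exact (iteratedFDeriv_add_apply (h1.of_le (mod_cast hm)) (h2.of_le (mod_cast hm))).symm

theorem CTendstoAt.prodMk {N : ℕ} {f : ι → E → F} {f₀ : E → F} {g : ι → E → G} {g₀ : E → G} {x : E}
    (hf : CTendstoAt N l f f₀ x) (hg : CTendstoAt N l g g₀ x) :
    CTendstoAt N l (fun i y ↦ (f i y, g i y)) (fun y ↦ (f₀ y, g₀ y)) x := by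
  have h1 := hf.comp_left (ContinuousLinearMap.inl ℝ F G).contDiff.contDiffAt
  have h2 := hg.comp_left (ContinuousLinearMap.inr ℝ F G).contDiff.contDiffAt
  simpa using h1.add h2

theorem CTendstoAt.fderiv {N : ℕ} {f : ι → E → F} {f₀ : E → F} {x : E}
    (h : CTendstoAt (N + 1) l f f₀ x) :
    CTendstoAt N l (fun i ↦ fderiv ℝ (f i)) (fderiv ℝ f₀) x := by
  refine ⟨?_, h.2.fderiv_right (by norm_cast), fun m hm ↦ ?_⟩
  · filter_upwards [h.1] with p hp using hp.fderiv_right (by norm_cast)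
  · have := h.3 (m + 1) (by omega)
    simp only [iteratedFDeriv_succ_eq_comp_right, Function.comp_def] at this
    exact (continuousMultilinearCurryRightEquiv' ℝ m E F).symm.isometry.isEmbedding.tendsto_nhds_iff.2
      this

theorem CTendstoAt.succ {N : ℕ} {f : ι → E → F} {f₀ : E → F} {x : E}
    (hf : ∀ᶠ p : ι × E in l ×ˢ 𝓝 x, ContDiffAt ℝ (N + 1 : ℕ) (f p.1) p.2)
    (hf₀ : ContDiffAt ℝ (N + 1 : ℕ) f₀ x)
    (h0 : Tendsto (fun p : ι × E ↦ f p.1 p.2) (l ×ˢ 𝓝 x) (𝓝 (f₀ x)))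
    (h : CTendstoAt N l (fun i ↦ _root_.fderiv ℝ (f i)) (_root_.fderiv ℝ f₀) x) :
    CTendstoAt (N + 1) l f f₀ x := by
  refine ⟨hf, hf₀, fun m hm ↦ ?_⟩
  rcases m with _ | m
  · exact tendsto_iteratedFDeriv_zero_iff.2 h0
  · have := h.3 m (by omega)
    simp only [iteratedFDeriv_succ_eq_comp_right, Function.comp_def]
    exact (continuousMultilinearCurryRightEquiv' ℝ m E F).symm.isometry.isEmbedding.tendsto_nhds_iff.1
      this

theorem Homeomorph.exists_fderiv_symm (e : E ≃ₜ E) (he : ContDiff ℝ ∞ e)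
    (he' : ContDiff ℝ ∞ e.symm) (y : E) :
    ∃ A : E ≃L[ℝ] E, _root_.fderiv ℝ e (e.symm y) = A ∧ _root_.fderiv ℝ e.symm y = A.symm := by
  have d1 : HasFDerivAt e (_root_.fderiv ℝ e (e.symm y)) (e.symm y) :=
    (he.differentiable (by simp) _).hasFDerivAt
  have d2 : HasFDerivAt e.symm (_root_.fderiv ℝ e.symm y) y :=
    (he'.differentiable (by simp) _).hasFDerivAt
  have c1 : (_root_.fderiv ℝ e (e.symm y)).comp (_root_.fderiv ℝ e.symm y) = .id ℝ E := by
    refine (d1.comp y d2).unique ?_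
    rw [e.self_comp_symm]
    exact hasFDerivAt_id y
  have c2 : (_root_.fderiv ℝ e.symm y).comp (_root_.fderiv ℝ e (e.symm y)) = .id ℝ E := by
    have d2' : HasFDerivAt e.symm (_root_.fderiv ℝ e.symm y) (e (e.symm y)) := by simpa using d2
    refine (d2'.comp (e.symm y) d1).unique ?_
    rw [e.symm_comp_self]
    exact hasFDerivAt_id _
  refine ⟨.equivOfInverse _ (_root_.fderiv ℝ e.symm y) (fun v ↦ ?_) (fun v ↦ ?_), rfl, rfl⟩
  · simpa using DFunLike.congr_fun c2 v
  · simpa using DFunLike.congr_fun c1 v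

/-- Inverses of a smoothly convergent family of diffeomorphisms, with a uniform Lipschitz bound,
converge smoothly. -/
theorem CTendstoAt.symm [CompleteSpace E] {K : NNReal} {f : ι → E ≃ₜ E} {f₀ : E ≃ₜ E}
    (hf : ∀ i, ContDiff ℝ ∞ (f i)) (hf₀ : ContDiff ℝ ∞ f₀)
    (hg : ∀ i, ContDiff ℝ ∞ (f i).symm) (hg₀ : ContDiff ℝ ∞ f₀.symm)
    (hK : ∀ i, LipschitzWith K (f i).symm)
    (h : ∀ (N : ℕ) (x : E), CTendstoAt N l (fun i ↦ f i) f₀ x) (N : ℕ) (y : E) :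
    CTendstoAt N l (fun i ↦ (f i).symm) f₀.symm y := by
  -- Order zero: with `x = f₀⁻¹ y`, the Lipschitz bound gives `dist (fᵢ⁻¹ y') x ≤ K dist y' (fᵢ x)`,
  -- and `fᵢ x → y`.
  have h0 : Tendsto (fun p : ι × E ↦ (f p.1).symm p.2) (l ×ˢ 𝓝 y) (𝓝 (f₀.symm y)) := by
    rw [tendsto_iff_dist_tendsto_zero]
    have h1 : Tendsto (fun p : ι × E ↦ f p.1 (f₀.symm y)) (l ×ˢ 𝓝 y) (𝓝 y) := by
      have h2 : Tendsto (fun p : ι × E ↦ (p.1, f₀.symm y)) (l ×ˢ 𝓝 y) (l ×ˢ 𝓝 (f₀.symm y)) :=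
        tendsto_fst.prodMk tendsto_const_nhds
      simpa [Function.comp_def] using (h 0 (f₀.symm y)).tendsto_zero.comp h2
    have h3 : Tendsto (fun p : ι × E ↦ K * dist p.2 (f p.1 (f₀.symm y))) (l ×ˢ 𝓝 y) (𝓝 0) := by
      simpa using (tendsto_snd.dist h1).const_mul (K : ℝ)
    refine squeeze_zero (fun _ ↦ dist_nonneg) (fun p ↦ ?_) h3
    simpa using (hK p.1).dist_le_mul p.2 (f p.1 (f₀.symm y))
  induction N with
  | zero =>
    refine ⟨.of_forall fun p ↦ (hg p.1).contDiffAt.of_le (mod_cast le_top),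
      hg₀.contDiffAt.of_le (mod_cast le_top), fun m hm ↦ ?_⟩
    obtain rfl : m = 0 := by omega
    exact tendsto_iteratedFDeriv_zero_iff (f := fun i ↦ (f i).symm).2 h0
  | succ N ih =>
    refine .succ (.of_forall fun p ↦ (hg p.1).contDiffAt.of_le (mod_cast le_top))
      (hg₀.contDiffAt.of_le (mod_cast le_top)) h0 ?_
    -- Since `D(e⁻¹) = (De ∘ e⁻¹)⁻¹` and inversion of operators is smooth, convergence of `e⁻¹` to
    -- order `N` gives that of its derivative to order `N`.
    have key' : ∀ e : E ≃ₜ E, ContDiff ℝ ∞ e → ContDiff ℝ ∞ e.symm →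
        ContinuousLinearMap.inverse ∘ (_root_.fderiv ℝ e ∘ e.symm) = _root_.fderiv ℝ e.symm := by
      intro e he he'
      ext1 y
      obtain ⟨A, h1, h2⟩ := e.exists_fderiv_symm he he' y
      simp [h1, h2]
    have h4 : CTendstoAt N l (fun i ↦ ContinuousLinearMap.inverse ∘ (_root_.fderiv ℝ (f i) ∘ (f i).symm))
        (ContinuousLinearMap.inverse ∘ (_root_.fderiv ℝ f₀ ∘ f₀.symm)) y := by
      refine CTendstoAt.comp_left ?_ (CTendstoAt.comp (h (N + 1) _).fderiv ih)
      obtain ⟨A, h1, h2⟩ := f₀.exists_fderiv_symm hf₀ hg₀ y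
      rw [Function.comp_apply, h1]
      exact contDiffAt_map_inverse A
    simpa only [key' _ (hf _) (hg _), key' _ hf₀ hg₀] using h4

theorem IsCompact.eventually_forall_of_prod {X : Type*} [TopologicalSpace X] {K : Set X}
    (hK : IsCompact K) {P : ι → X → Prop}
    (h : ∀ x ∈ K, ∀ᶠ p : ι × X in l ×ˢ 𝓝 x, P p.1 p.2) : ∀ᶠ i in l, ∀ x ∈ K, P i x := by
  have h' : ∀ᶠ p : ι × X in l ×ˢ 𝓝ˢ K, P p.1 p.2 := by
    exact hK.mem_prod_nhdsSet_of_forall h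
  obtain ⟨u, hu, v, hv, huv⟩ := Filter.eventually_prod_iff.1 h'
  exact hu.mono fun i hi x hx ↦ huv hi (Filter.Eventually.self_of_nhdsSet hv x hx)

/-- With `TendstoUniformlyOn.tendsto_prod`, this translates between uniform convergence on compact
sets and continuous convergence, the form that is stable under composition. -/
theorem IsCompact.tendstoUniformlyOn_of_prod {X Y : Type*} [TopologicalSpace X]
    [PseudoMetricSpace Y] {K : Set X} (hK : IsCompact K) {A : ι → X → Y} {a : X → Y}
    (h : ∀ x ∈ K, Tendsto (fun p : ι × X ↦ A p.1 p.2) (l ×ˢ 𝓝 x) (𝓝 (a x)))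
    (ha : ∀ x ∈ K, ContinuousAt a x) : TendstoUniformlyOn A a l K := by
  rw [Metric.tendstoUniformlyOn_iff]
  intro ε hε
  refine hK.eventually_forall_of_prod fun x hx ↦ ?_
  have h1 := ((ha x hx).tendsto.comp tendsto_snd).dist (h x hx)
  rw [dist_self] at h1
  exact h1.eventually_lt_const hε

theorem TendstoUniformlyOn.tendsto_prod {X Y : Type*} [TopologicalSpace X]
    [PseudoMetricSpace Y] {K : Set X} {A : ι → X → Y} {a : X → Y} (h : TendstoUniformlyOn A a l K)
    {x : X} (hK : K ∈ 𝓝 x) (ha : ContinuousAt a x) :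
    Tendsto (fun p : ι × X ↦ A p.1 p.2) (l ×ˢ 𝓝 x) (𝓝 (a x)) := by
  rw [tendsto_iff_dist_tendsto_zero]
  have h1 : Tendsto (fun p : ι × X ↦ dist (a p.2) (A p.1 p.2)) (l ×ˢ 𝓝 x) (𝓝 0) := by
    rw [Metric.tendsto_nhds]
    intro ε hε
    filter_upwards [(Metric.tendstoUniformlyOn_iff.1 h ε hε).prod_mk hK] with p hp
    simpa using hp.1 p.2 hp.2
  have h2 : Tendsto (fun p : ι × X ↦ dist (a p.2) (a x)) (l ×ˢ 𝓝 x) (𝓝 0) :=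
    (tendsto_iff_dist_tendsto_zero.1 ha).comp tendsto_snd
  refine squeeze_zero (fun _ ↦ dist_nonneg) (fun p ↦ dist_triangle_left _ _ (a p.2)) ?_
  simpa using h1.add h2

end SmoothConvergence

/-! ### Neumann series in weighted convolution algebras. -/

section WeightedSums

theorem ENNReal.mul_one_sub_inv_ne_top {t : ENNReal} (ht : t < 1) : t * (1 - t)⁻¹ ≠ ⊤ :=
  ENNReal.mul_ne_top ht.ne_top (ENNReal.inv_ne_top.2 (tsub_pos_of_lt ht).ne')

open scoped ENNReal NNReal

variable {Γ : Type*}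

/-- The weighted `ℓ¹` norm of a family of coefficients, as an extended nonnegative real. -/
noncomputable def wnorm (w : Γ → ℝ≥0∞) (a : Γ → ℂ) : ℝ≥0∞ := ∑' k, w k * ‖a k‖ₑ

theorem wnorm_mono {w w' : Γ → ℝ≥0∞} {a b : Γ → ℂ} (hw : ∀ k, w k ≤ w' k)
    (hab : ∀ k, ‖a k‖ ≤ ‖b k‖) : wnorm w a ≤ wnorm w' b :=
  ENNReal.tsum_le_tsum fun k ↦ mul_le_mul' (hw k) (enorm_le_iff_norm_le.2 (hab k))

theorem wnorm_add_le (w : Γ → ℝ≥0∞) (a b : Γ → ℂ) :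
    wnorm w (fun k ↦ a k + b k) ≤ wnorm w a + wnorm w b := by
  rw [wnorm, wnorm, wnorm, ← ENNReal.tsum_add]
  refine ENNReal.tsum_le_tsum fun k ↦ ?_
  rw [← mul_add]
  gcongr
  exact enorm_add_le _ _

theorem wnorm_sub_le (w : Γ → ℝ≥0∞) (a b : Γ → ℂ) :
    wnorm w (fun k ↦ a k - b k) ≤ wnorm w a + wnorm w b := by
  have := wnorm_add_le w a (fun k ↦ -b k)
  simpa [sub_eq_add_neg, wnorm] using this

theorem wnorm_tsum_le {α : Type*} (w : Γ → ℝ≥0∞) (a : α → Γ → ℂ) :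
    wnorm w (fun k ↦ ∑' i, a i k) ≤ ∑' i, wnorm w (a i) := by
  unfold wnorm
  rw [ENNReal.tsum_comm]
  refine ENNReal.tsum_le_tsum fun k ↦ ?_
  rw [ENNReal.tsum_mul_left]
  gcongr
  exact enorm_tsum_le_tsum_enorm

theorem wnorm_mul_le {w : Γ → ℝ≥0∞} {m : Γ → ℂ} (hm : ∀ k, ‖m k‖ ≤ 1)
    (b : Γ → ℂ) : wnorm w (fun l ↦ m l * b l) ≤ wnorm w b :=
  wnorm_mono (fun _ ↦ le_rfl) fun k ↦ by
    simpa using mul_le_mul_of_nonneg_right (hm k) (norm_nonneg (b k))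

variable [AddCommGroup Γ]

/-- Convolution of families of coefficients. -/
noncomputable def coeffConv (a b : Γ → ℂ) (k : Γ) : ℂ := ∑' l, a (k - l) * b l

/-- A submultiplicative weight bounded below by one. -/
structure IsCoeffWeight (w : Γ → ℝ≥0∞) : Prop where
  one_le : ∀ k, 1 ≤ w k
  map_add_le : ∀ k l, w (k + l) ≤ w k * w l

theorem tsum_tsum_conv {w : Γ → ℝ≥0∞} (a b : Γ → ℂ) :
    ∑' k, ∑' l, (w (k - l) * w l) * (‖a (k - l)‖ₑ * ‖b l‖ₑ) = wnorm w a * wnorm w b := by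
  have h : ∀ k l, (w (k - l) * w l) * (‖a (k - l)‖ₑ * ‖b l‖ₑ) =
      (w (k - l) * ‖a (k - l)‖ₑ) * (w l * ‖b l‖ₑ) := fun k l ↦ by ring
  simp_rw [h]
  rw [ENNReal.tsum_comm]
  simp_rw [ENNReal.tsum_mul_right]
  have h2 : ∀ l, ∑' k, w (k - l) * ‖a (k - l)‖ₑ = wnorm w a := fun l ↦
    (Equiv.subRight l).tsum_eq fun k ↦ w k * ‖a k‖ₑ
  simp_rw [h2, ENNReal.tsum_mul_left]
  rfl

/-- Submultiplicativity, `w k ≤ w (k - l) * w l`, lets the weight be distributed over the two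
factors of each term. -/
theorem IsCoeffWeight.wnorm_conv_le {w : Γ → ℝ≥0∞} (hw : IsCoeffWeight w) (a b : Γ → ℂ) :
    wnorm w (coeffConv a b) ≤ wnorm w a * wnorm w b := by
  rw [← tsum_tsum_conv]
  refine ENNReal.tsum_le_tsum fun k ↦ ?_
  rw [coeffConv]
  refine (mul_le_mul_right enorm_tsum_le_tsum_enorm _).trans ?_
  rw [← ENNReal.tsum_mul_left]
  refine ENNReal.tsum_le_tsum fun l ↦ ?_
  rw [enorm_mul]
  gcongr
  simpa using hw.map_add_le (k - l) l

theorem IsCoeffWeight.summable_conv {w : Γ → ℝ≥0∞} (hw : IsCoeffWeight w) {a b : Γ → ℂ}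
    (ha : wnorm w a ≠ ⊤) (hb : wnorm w b ≠ ⊤) (k : Γ) : Summable fun l ↦ a (k - l) * b l := by
  refine Summable.of_enorm (ne_top_of_le_ne_top (ENNReal.mul_ne_top ha hb) ?_)
  rw [← tsum_tsum_conv]
  refine le_trans ?_ (ENNReal.le_tsum k)
  refine ENNReal.tsum_le_tsum fun l ↦ ?_
  rw [enorm_mul]
  exact le_mul_of_one_le_left' (one_le_mul (hw.one_le _) (hw.one_le _))

variable (a m : Γ → ℂ)

/-- The terms of the Neumann series for `h = a + a * (m h)`. -/
noncomputable def neumannTerm : ℕ → Γ → ℂ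
  | 0 => a
  | n + 1 => coeffConv a fun l ↦ m l * neumannTerm n l

/-- The solution of `h = a + a * (m h)` as a Neumann series. -/
noncomputable def neumannSol (k : Γ) : ℂ := ∑' n, neumannTerm a m n k

variable {a m} {w : Γ → ℝ≥0∞}

theorem IsCoeffWeight.wnorm_neumannTerm_le (hw : IsCoeffWeight w) (hm : ∀ k, ‖m k‖ ≤ 1) (n : ℕ) :
    wnorm w (neumannTerm a m n) ≤ wnorm w a * wnorm w a ^ n := by
  induction n with
  | zero => simp [neumannTerm]
  | succ n ih =>
    calc wnorm w (neumannTerm a m (n + 1)) ≤ wnorm w a * wnorm w (fun l ↦ m l * neumannTerm a m n l) :=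
          hw.wnorm_conv_le _ _
      _ ≤ wnorm w a * (wnorm w a * wnorm w a ^ n) := by
          gcongr
          exact (wnorm_mul_le hm _).trans ih
      _ = _ := by ring

theorem IsCoeffWeight.tsum_wnorm_neumannTerm_le (hw : IsCoeffWeight w) (hm : ∀ k, ‖m k‖ ≤ 1) :
    ∑' n, wnorm w (neumannTerm a m n) ≤ wnorm w a * (1 - wnorm w a)⁻¹ := by
  rw [← ENNReal.tsum_geometric, ← ENNReal.tsum_mul_left]
  exact ENNReal.tsum_le_tsum fun n ↦ hw.wnorm_neumannTerm_le hm n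

theorem IsCoeffWeight.wnorm_neumannSol_le (hw : IsCoeffWeight w) (hm : ∀ k, ‖m k‖ ≤ 1) :
    wnorm w (neumannSol a m) ≤ wnorm w a * (1 - wnorm w a)⁻¹ :=
  (wnorm_tsum_le w _).trans (hw.tsum_wnorm_neumannTerm_le hm)

/-- The geometric bound on the terms makes the double sum absolutely convergent, so convolution with
`a` may be exchanged with the sum of the series. -/
theorem IsCoeffWeight.neumannSol_eq (hw : IsCoeffWeight w) (hm : ∀ k, ‖m k‖ ≤ 1)
    (ha : wnorm w a < 1) (k : Γ) :
    neumannSol a m k = a k + coeffConv a (fun l ↦ m l * neumannSol a m l) k := by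
  have hfin : ∑' n, wnorm w (neumannTerm a m n) ≠ ⊤ :=
    ne_top_of_le_ne_top (ENNReal.mul_one_sub_inv_ne_top ha) (hw.tsum_wnorm_neumannTerm_le hm)
  have hs : ∀ l, Summable fun n ↦ neumannTerm a m n l := fun l ↦ by
    refine Summable.of_enorm (ne_top_of_le_ne_top hfin ?_)
    refine ENNReal.tsum_le_tsum fun n ↦ le_trans ?_ (ENNReal.le_tsum l)
    exact le_mul_of_one_le_left' (hw.one_le l)
  have h1 : neumannSol a m k = a k + ∑' n, neumannTerm a m (n + 1) k := by
    rw [neumannSol, (hs k).tsum_eq_zero_add]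
    rfl
  rw [h1]
  congr 1
  simp only [neumannTerm, coeffConv, neumannSol, ← tsum_mul_left]
  refine Summable.tsum_comm (Summable.of_enorm (ne_top_of_le_ne_top
    (ENNReal.mul_ne_top ha.ne_top hfin) ?_))
  rw [ENNReal.tsum_prod', ENNReal.tsum_comm, ← ENNReal.tsum_mul_left]
  refine ENNReal.tsum_le_tsum fun n ↦ ?_
  rw [← tsum_tsum_conv]
  refine le_trans ?_ (ENNReal.le_tsum k)
  refine ENNReal.tsum_le_tsum fun l ↦ ?_
  rw [Function.uncurry_apply_pair, enorm_mul, enorm_mul]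
  refine le_trans ?_ (le_mul_of_one_le_left' (one_le_mul (hw.one_le _) (hw.one_le _)))
  gcongr
  refine mul_le_of_le_one_left' ?_
  simpa [enorm_le_iff_norm_le] using enorm_le_iff_norm_le.2 ((hm l).trans_eq (norm_one (α := ℂ)).symm)

theorem IsCoeffWeight.wnorm_neumannSol_sub_le (hw : IsCoeffWeight w) (hm : ∀ k, ‖m k‖ ≤ 1)
    {b : Γ → ℂ} (ha : wnorm w a < 1) (hb : wnorm w b ≤ 1 / 2) :
    wnorm w (fun k ↦ neumannSol b m k - neumannSol a m k) ≤
      2 * (wnorm w (fun k ↦ b k - a k) * (1 + wnorm w (neumannSol a m))) := by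
  have hb1 : wnorm w b < 1 := hb.trans_lt (by norm_num)
  have fa : wnorm w (neumannSol a m) ≠ ⊤ :=
    ne_top_of_le_ne_top (ENNReal.mul_one_sub_inv_ne_top ha) (hw.wnorm_neumannSol_le hm)
  have fb : wnorm w (neumannSol b m) ≠ ⊤ :=
    ne_top_of_le_ne_top (ENNReal.mul_one_sub_inv_ne_top hb1) (hw.wnorm_neumannSol_le hm)
  set D := wnorm w (fun k ↦ neumannSol b m k - neumannSol a m k) with hD
  have fD : D ≠ ⊤ := ne_top_of_le_ne_top (ENNReal.add_ne_top.2 ⟨fb, fa⟩) (wnorm_sub_le _ _ _)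
  have fm : ∀ c : Γ → ℂ, wnorm w c ≠ ⊤ → wnorm w (fun l ↦ m l * c l) ≠ ⊤ := fun c hc ↦
    ne_top_of_le_ne_top hc (wnorm_mul_le hm _)
  -- Subtracting the equations: `h_b - h_a = (b - a) + (b - a) * (m h_a) + b * (m (h_b - h_a))`. As
  -- `‖b‖ ≤ 1/2`, the last term is absorbed on the left, at the price of the factor 2.
  have key : (fun k ↦ neumannSol b m k - neumannSol a m k) = fun k ↦
      ((b k - a k) + coeffConv (fun k ↦ b k - a k) (fun l ↦ m l * neumannSol a m l) k) +
        coeffConv b (fun l ↦ m l * (neumannSol b m l - neumannSol a m l)) k := by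
    ext k
    rw [hw.neumannSol_eq hm ha k, hw.neumannSol_eq hm hb1 k]
    have s1 := hw.summable_conv hb1.ne_top (fm _ fb) k
    have s2 := hw.summable_conv ha.ne_top (fm _ fa) k
    have s3 := hw.summable_conv hb1.ne_top (fm _ fa) k
    have e1 : coeffConv (fun k ↦ b k - a k) (fun l ↦ m l * neumannSol a m l) k =
        coeffConv b (fun l ↦ m l * neumannSol a m l) k -
          coeffConv a (fun l ↦ m l * neumannSol a m l) k := by
      simp only [coeffConv, sub_mul]
      exact s3.tsum_sub s2
    have e2 : coeffConv b (fun l ↦ m l * (neumannSol b m l - neumannSol a m l)) k =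
        coeffConv b (fun l ↦ m l * neumannSol b m l) k -
          coeffConv b (fun l ↦ m l * neumannSol a m l) k := by
      simp only [coeffConv, mul_sub]
      exact s1.tsum_sub s3
    rw [e1, e2]
    ring
  have hDle : D ≤ wnorm w (fun k ↦ b k - a k) * (1 + wnorm w (neumannSol a m)) + 1 / 2 * D := by
    rw [hD]
    nth_rewrite 1 [key]
    refine (wnorm_add_le _ _ _).trans (add_le_add ((wnorm_add_le _ _ _).trans ?_) ?_)
    · rw [mul_add, mul_one]
      gcongr
      refine (hw.wnorm_conv_le _ _).trans ?_
      gcongr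
      exact wnorm_mul_le hm _
    · refine (hw.wnorm_conv_le _ _).trans ?_
      gcongr
      exact wnorm_mul_le hm _
  have hhalf : D = 1 / 2 * D + 1 / 2 * D := by
    rw [← add_mul, ENNReal.add_halves, one_mul]
  have hle : 1 / 2 * D ≤ wnorm w (fun k ↦ b k - a k) * (1 + wnorm w (neumannSol a m)) := by
    nth_rewrite 1 [hhalf] at hDle
    exact (ENNReal.add_le_add_iff_right (ENNReal.mul_ne_top (by norm_num) fD)).1 hDle
  calc D = 2 * (1 / 2 * D) := by
        rw [← mul_assoc, one_div, ENNReal.mul_inv_cancel two_ne_zero (by norm_num), one_mul]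
    _ ≤ _ := by gcongr

theorem tendsto_wnorm_of_dominated {Γ : Type*} {α : Type*} {l : Filter α}
    [l.IsCountablyGenerated] {w : α → Γ → ℝ≥0∞} {w₀ W : Γ → ℝ≥0∞} {a : Γ → ℂ}
    (hW : ∀ᶠ i in l, ∀ k, w i k ≤ W k) (ha : wnorm W a ≠ ⊤)
    (h : ∀ k, Tendsto (fun i ↦ w i k) l (𝓝 (w₀ k))) :
    Tendsto (fun i ↦ wnorm (w i) a) l (𝓝 (wnorm w₀ a)) := by
  let _ : MeasurableSpace Γ := ⊤
  simp only [wnorm, ← MeasureTheory.lintegral_count] at ha ⊢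
  refine MeasureTheory.tendsto_lintegral_filter_of_dominated_convergence
    (fun k ↦ W k * ‖a k‖ₑ) (.of_forall fun _ ↦ measurable_from_top) ?_ ha
    (.of_forall fun k ↦ ENNReal.Tendsto.mul_const (h k) (.inr enorm_ne_top))
  filter_upwards [hW] with i hi
  exact .of_forall fun k ↦ by gcongr; exact hi k

/-- The lattice of Gaussian integers in the plane. -/
def gaussInt (k : ℤ × ℤ) : ℂ := ⟨k.1, k.2⟩

theorem gaussInt_add (k l : ℤ × ℤ) : gaussInt (k + l) = gaussInt k + gaussInt l := by
  apply Complex.ext <;> simp [gaussInt]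

/-- The weight `(1 + η |k|) ^ s`. -/
noncomputable def latticeWeight (η : ℝ≥0) (s : ℕ) (k : ℤ × ℤ) : ℝ≥0∞ :=
  (1 + η * ‖gaussInt k‖ₑ) ^ s

theorem isCoeffWeight_latticeWeight (η : ℝ≥0) (s : ℕ) : IsCoeffWeight (latticeWeight η s) where
  one_le k := one_le_pow₀ le_self_add
  map_add_le k l := by
    rw [latticeWeight, latticeWeight, latticeWeight, ← mul_pow]
    gcongr
    calc 1 + η * ‖gaussInt (k + l)‖ₑ ≤ 1 + η * (‖gaussInt k‖ₑ + ‖gaussInt l‖ₑ) := by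
          gcongr
          rw [gaussInt_add]
          exact enorm_add_le _ _
      _ ≤ 1 + η * (‖gaussInt k‖ₑ + ‖gaussInt l‖ₑ) + η * ‖gaussInt k‖ₑ * (η * ‖gaussInt l‖ₑ) :=
          le_self_add
      _ = _ := by ring

theorem latticeWeight_le (η : ℝ≥0) (hη : η ≤ 1) (s : ℕ) (k : ℤ × ℤ) :
    latticeWeight η s k ≤ latticeWeight 1 s k := by
  unfold latticeWeight
  gcongr

theorem latticeWeight_one_le (η : ℝ≥0) (hη : η ≤ 1) (h0 : 0 < η) (s : ℕ) (k : ℤ × ℤ) :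
    latticeWeight 1 s k ≤ ((η : ℝ≥0∞)⁻¹) ^ s * latticeWeight η s k := by
  unfold latticeWeight
  rw [← mul_pow]
  gcongr
  rw [mul_add, mul_one, ← mul_assoc,
    ENNReal.inv_mul_cancel (by simpa using h0.ne') ENNReal.coe_ne_top]
  gcongr
  · exact ENNReal.one_le_inv.2 (by exact_mod_cast hη)
  · simp

/-- A weight of order `s` for which the norm of `a` stays below a bound valid without weight. -/
theorem exists_latticeWeight_lt {a : ℤ × ℤ → ℂ} {s : ℕ} (ha : wnorm (latticeWeight 1 s) a ≠ ⊤)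
    {δ : ℝ≥0∞} (hδ : wnorm (latticeWeight 1 0) a < δ) :
    ∃ η : ℝ≥0, 0 < η ∧ η ≤ 1 ∧ wnorm (latticeWeight η s) a < δ := by
  -- As `η → 0` the weights tend pointwise to `1` and are dominated by the weight with `η = 1`, for
  -- which `a` has finite norm.
  have h1 : Tendsto (fun η : ℝ≥0 ↦ wnorm (latticeWeight η s) a) (𝓝[>] 0)
      (𝓝 (wnorm (fun _ ↦ 1) a)) := by
    refine tendsto_wnorm_of_dominated (W := latticeWeight 1 s) ?_ ha fun k ↦ ?_
    · filter_upwards [Ioc_mem_nhdsGT (zero_lt_one (α := ℝ≥0))] with η hη k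
      exact latticeWeight_le η hη.2 s k
    · have : Tendsto (fun η : ℝ≥0 ↦ latticeWeight η s k) (𝓝 0) (𝓝 ((1 + (0 : ℝ≥0) * ‖gaussInt k‖ₑ) ^ s)) := by
        refine ENNReal.Tendsto.pow ?_
        refine tendsto_const_nhds.add (ENNReal.Tendsto.mul_const ?_ (.inr enorm_ne_top))
        exact ENNReal.tendsto_coe.2 tendsto_id
      simpa using this.mono_left nhdsWithin_le_nhds
  have h2 : wnorm (fun _ ↦ 1) a < δ := by simpa [wnorm, latticeWeight] using hδ
  obtain ⟨η, h3, h4⟩ := ((h1.eventually_lt_const h2).and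
    (Ioc_mem_nhdsGT (zero_lt_one (α := ℝ≥0)))).exists
  exact ⟨η, h4.1, h4.2, h3⟩

theorem wnorm_latticeWeight_one_le (η : ℝ≥0) (hη : η ≤ 1) (h0 : 0 < η) (s : ℕ) (a : ℤ × ℤ → ℂ) :
    wnorm (latticeWeight 1 s) a ≤ ((η : ℝ≥0∞)⁻¹) ^ s * wnorm (latticeWeight η s) a := by
  rw [wnorm, wnorm, ← ENNReal.tsum_mul_left]
  refine ENNReal.tsum_le_tsum fun k ↦ ?_
  rw [← mul_assoc]
  gcongr
  exact latticeWeight_one_le η hη h0 s k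

theorem inv_pow_ne_top {η : ℝ≥0} (h0 : 0 < η) (s : ℕ) : ((η : ℝ≥0∞)⁻¹) ^ s ≠ ⊤ :=
  ENNReal.pow_ne_top (ENNReal.inv_ne_top.2 (by simpa using h0.ne'))

/-- Smallness is needed only in `ℓ¹`: for small `η` the weighted norm is still below `1`, so the
series converges in that norm, and returning to `η = 1` costs a finite factor `η⁻ˢ`. -/
theorem wnorm_latticeWeight_neumannSol_ne_top {a m : ℤ × ℤ → ℂ} (hm : ∀ k, ‖m k‖ ≤ 1) {s : ℕ}
    (ha : wnorm (latticeWeight 1 s) a ≠ ⊤) (h : wnorm (latticeWeight 1 0) a < 1) :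
    wnorm (latticeWeight 1 s) (neumannSol a m) ≠ ⊤ := by
  obtain ⟨η, h0, h1, hη⟩ := exists_latticeWeight_lt ha h
  refine ne_top_of_le_ne_top (ENNReal.mul_ne_top (inv_pow_ne_top h0 s) ?_)
    (wnorm_latticeWeight_one_le η h1 h0 s _)
  exact ne_top_of_le_ne_top (ENNReal.mul_one_sub_inv_ne_top hη)
    ((isCoeffWeight_latticeWeight η s).wnorm_neumannSol_le hm)

theorem tendsto_wnorm_neumannSol_sub {ι : Type*} {l : Filter ι} {a : ι → ℤ × ℤ → ℂ}
    {a₀ m : ℤ × ℤ → ℂ} (hm : ∀ k, ‖m k‖ ≤ 1) {s : ℕ}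
    (ha : wnorm (latticeWeight 1 s) a₀ ≠ ⊤) (h : wnorm (latticeWeight 1 0) a₀ < 1 / 4)
    (hlim : Tendsto (fun i ↦ wnorm (latticeWeight 1 s) (fun k ↦ a i k - a₀ k)) l (𝓝 0)) :
    Tendsto (fun i ↦ wnorm (latticeWeight 1 s) (fun k ↦ neumannSol (a i) m k - neumannSol a₀ m k)) l
      (𝓝 0) := by
  obtain ⟨η, h0, h1, hη⟩ := exists_latticeWeight_lt ha h
  have hw := isCoeffWeight_latticeWeight η s
  have hη1 : wnorm (latticeWeight η s) a₀ < 1 := hη.trans (by norm_num)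
  have hmono : ∀ c : ℤ × ℤ → ℂ, wnorm (latticeWeight η s) c ≤ wnorm (latticeWeight 1 s) c :=
    fun c ↦ wnorm_mono (latticeWeight_le η h1 s) fun _ ↦ le_rfl
  -- The limit contributes less than `1/4` and the perturbation eventually less than `1/4`, which
  -- meets the bound `1/2` of `wnorm_neumannSol_sub_le`.
  have hev : ∀ᶠ i in l, wnorm (latticeWeight η s) (a i) ≤ 1 / 2 := by
    have h4 : (0 : ℝ≥0∞) < 1 / 4 := by norm_num
    filter_upwards [hlim.eventually_lt_const h4] with i hi
    have e : a i = fun k ↦ (a i k - a₀ k) + a₀ k := by ext; ring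
    rw [e]
    refine (wnorm_add_le _ _ _).trans ((add_le_add ((hmono _).trans hi.le) hη.le).trans ?_)
    rw [← two_mul, show (4 : ℝ≥0∞) = 2 * 2 by norm_num, one_div,
      ENNReal.mul_inv (by norm_num) (by norm_num), ← mul_assoc,
      ENNReal.mul_inv_cancel two_ne_zero (by norm_num), one_mul, one_div]
  have hC : 1 + wnorm (latticeWeight η s) (neumannSol a₀ m) ≠ ⊤ :=
    ENNReal.add_ne_top.2 ⟨by simp, ne_top_of_le_ne_top (ENNReal.mul_one_sub_inv_ne_top hη1)
      (hw.wnorm_neumannSol_le hm)⟩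
  have hbd : Tendsto (fun i ↦ ((η : ℝ≥0∞)⁻¹) ^ s * (2 * (wnorm (latticeWeight 1 s)
      (fun k ↦ a i k - a₀ k) * (1 + wnorm (latticeWeight η s) (neumannSol a₀ m))))) l (𝓝 0) := by
    have := ENNReal.Tendsto.const_mul (ENNReal.Tendsto.const_mul
      (ENNReal.Tendsto.mul_const hlim (.inr hC)) (.inr (by norm_num : (2 : ℝ≥0∞) ≠ ⊤)))
      (.inr (inv_pow_ne_top h0 s))
    simpa using this
  refine tendsto_of_tendsto_of_tendsto_of_le_of_le' tendsto_const_nhds hbd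
    (.of_forall fun _ ↦ zero_le) ?_
  filter_upwards [hev] with i hi
  refine (wnorm_latticeWeight_one_le η h1 h0 s _).trans ?_
  gcongr
  refine (hw.wnorm_neumannSol_sub_le hm hη1 hi).trans ?_
  gcongr
  exact hmono _

end WeightedSums

/-! ### Absolutely convergent Fourier series on the plane. -/

section FourierSynthesis

open scoped ENNReal NNReal ComplexConjugate
open Complex (I)

/-- The character `x ↦ exp (2 π i ⟨k, x⟩)` of the plane attached to a Gaussian integer. -/
noncomputable def latticeChar (k : ℤ × ℤ) (x : ℂ) : ℂ :=
  Complex.exp (2 * Real.pi * I * (inner ℝ (gaussInt k) x : ℝ))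

theorem norm_latticeChar (k : ℤ × ℤ) (x : ℂ) : ‖latticeChar k x‖ = 1 := by
  have : (2 * Real.pi * I * (inner ℝ (gaussInt k) x : ℝ) : ℂ) =
      ((2 * Real.pi * inner ℝ (gaussInt k) x : ℝ) : ℂ) * I := by push_cast; ring
  rw [latticeChar, this, Complex.norm_exp_ofReal_mul_I]

theorem latticeChar_add (k l : ℤ × ℤ) (x : ℂ) :
    latticeChar (k + l) x = latticeChar k x * latticeChar l x := by
  rw [latticeChar, latticeChar, latticeChar, ← Complex.exp_add, gaussInt_add, inner_add_left]
  push_cast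
  ring_nf

theorem latticeChar_zero (x : ℂ) : latticeChar 0 x = 1 := by
  have : gaussInt 0 = 0 := by apply Complex.ext <;> simp [gaussInt]
  simp [latticeChar, this]

theorem hasDerivAt_cexp_ofReal_mul (c : ℂ) (t : ℝ) :
    HasDerivAt (fun t : ℝ ↦ Complex.exp (c * t)) (c * Complex.exp (c * t)) t := by
  have h : HasDerivAt (fun t : ℝ ↦ c * (t : ℂ)) c t := by
    simpa using (Complex.ofRealCLM.hasDerivAt (x := t)).const_mul c
  simpa [mul_comm] using h.cexp

theorem iteratedDeriv_cexp_ofReal_mul (c : ℂ) (m : ℕ) :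
    iteratedDeriv m (fun t : ℝ ↦ Complex.exp (c * t)) =
      fun t : ℝ ↦ c ^ m * Complex.exp (c * t) := by
  induction m with
  | zero => simp
  | succ m ih =>
    rw [iteratedDeriv_succ, ih]
    ext t
    rw [((hasDerivAt_cexp_ofReal_mul c t).const_mul (c ^ m)).deriv]
    ring

theorem contDiff_cexp_ofReal_mul (c : ℂ) : ContDiff ℝ ∞ fun t : ℝ ↦ Complex.exp (c * t) := by
  have h : ContDiff ℝ ∞ fun t : ℝ ↦ (t : ℂ) := Complex.ofRealCLM.contDiff
  exact (contDiff_const.mul h).cexp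

theorem latticeChar_eq_comp (k : ℤ × ℤ) :
    latticeChar k = (fun t : ℝ ↦ Complex.exp ((2 * Real.pi * I) * t)) ∘ innerSL ℝ (gaussInt k) := by
  ext x
  simp [latticeChar]

theorem contDiff_latticeChar (k : ℤ × ℤ) : ContDiff ℝ ∞ (latticeChar k) := by
  rw [latticeChar_eq_comp]
  exact (contDiff_cexp_ofReal_mul _).comp (innerSL ℝ (gaussInt k)).contDiff

theorem norm_iteratedFDeriv_latticeChar_le (k : ℤ × ℤ) (m : ℕ) (x : ℂ) :
    ‖iteratedFDeriv ℝ m (latticeChar k) x‖ ≤ (2 * Real.pi) ^ m * ‖gaussInt k‖ ^ m := by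
  rw [latticeChar_eq_comp, ContinuousLinearMap.iteratedFDeriv_comp_right _
    (contDiff_cexp_ofReal_mul _) _ (mod_cast le_top)]
  refine (ContinuousMultilinearMap.norm_compContinuousLinearMap_le _ _).trans ?_
  rw [norm_iteratedFDeriv_eq_norm_iteratedDeriv, iteratedDeriv_cexp_ofReal_mul]
  have h1 : ‖Complex.exp (2 * Real.pi * I * (innerSL ℝ (gaussInt k) x : ℝ))‖ = 1 :=
    norm_latticeChar k x
  rw [norm_mul, h1]
  simp [abs_of_pos Real.pi_pos]

theorem hasFDerivAt_latticeChar (k : ℤ × ℤ) (x : ℂ) :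
    HasFDerivAt (latticeChar k)
      ((innerSL ℝ (gaussInt k)).smulRight (2 * Real.pi * I * latticeChar k x)) x := by
  have h := (hasDerivAt_cexp_ofReal_mul (2 * Real.pi * I)
    (innerSL ℝ (gaussInt k) x)).hasFDerivAt.comp x (innerSL ℝ (gaussInt k)).hasFDerivAt
  have e : Complex.exp (2 * Real.pi * I * (innerSL ℝ (gaussInt k) x : ℝ)) = latticeChar k x := rfl
  rw [e, ← latticeChar_eq_comp] at h
  refine h.congr_fderiv ?_
  ext
  simp

/-- The sum of the absolutely convergent Fourier series with coefficients `b`. -/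
noncomputable def synth (b : ℤ × ℤ → ℂ) (x : ℂ) : ℂ := ∑' k, b k * latticeChar k x

/-- Families of coefficients which are rapidly decreasing. -/
def RapidDecay (b : ℤ × ℤ → ℂ) : Prop := ∀ s, wnorm (latticeWeight 1 s) b ≠ ⊤

theorem RapidDecay.mul_of_norm_le_one {b m : ℤ × ℤ → ℂ} (hb : RapidDecay b)
    (hm : ∀ k, ‖m k‖ ≤ 1) : RapidDecay fun k ↦ m k * b k := fun s ↦
  ne_top_of_le_ne_top (hb s) (wnorm_mul_le hm b)

theorem RapidDecay.sub {b c : ℤ × ℤ → ℂ} (hb : RapidDecay b) (hc : RapidDecay c) :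
    RapidDecay fun k ↦ b k - c k := fun s ↦
  ne_top_of_le_ne_top (ENNReal.add_ne_top.2 ⟨hb s, hc s⟩) (wnorm_sub_le _ b c)

theorem enorm_latticeWeight (s : ℕ) (b : ℤ × ℤ → ℂ) (k : ℤ × ℤ) :
    latticeWeight 1 s k * ‖b k‖ₑ = ‖(1 + ‖gaussInt k‖) ^ s * ‖b k‖‖ₑ := by
  rw [enorm_mul, enorm_pow, Real.enorm_of_nonneg (by positivity : 0 ≤ 1 + ‖gaussInt k‖),
    ENNReal.ofReal_add (by simp) (by positivity), ofReal_norm, enorm_norm, latticeWeight]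
  simp

theorem summable_iff_wnorm_ne_top {b : ℤ × ℤ → ℂ} {s : ℕ} :
    (Summable fun k ↦ (1 + ‖gaussInt k‖) ^ s * ‖b k‖) ↔ wnorm (latticeWeight 1 s) b ≠ ⊤ := by
  simp only [wnorm, enorm_latticeWeight, tsum_enorm_ne_top_iff_summable_norm]
  exact summable_norm_iff.symm

theorem toReal_wnorm (b : ℤ × ℤ → ℂ) (s : ℕ) :
    (wnorm (latticeWeight 1 s) b).toReal = ∑' k, (1 + ‖gaussInt k‖) ^ s * ‖b k‖ := by
  simp only [wnorm, enorm_latticeWeight]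
  rw [ENNReal.tsum_toReal_eq fun _ ↦ enorm_ne_top]
  refine tsum_congr fun k ↦ ?_
  rw [toReal_enorm, Real.norm_of_nonneg (by positivity)]

theorem norm_iteratedFDeriv_mul_latticeChar_le (b : ℤ × ℤ → ℂ) (m : ℕ) (k : ℤ × ℤ) (x : ℂ) :
    ‖iteratedFDeriv ℝ m (fun y ↦ b k * latticeChar k y) x‖ ≤
      (2 * Real.pi) ^ m * ((1 + ‖gaussInt k‖) ^ m * ‖b k‖) := by
  have h : iteratedFDeriv ℝ m (fun y ↦ b k * latticeChar k y) x =
      (ContinuousLinearMap.mul ℝ ℂ (b k)).compContinuousMultilinearMap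
        (iteratedFDeriv ℝ m (latticeChar k) x) :=
    (ContinuousLinearMap.mul ℝ ℂ (b k)).iteratedFDeriv_comp_left
      (contDiff_latticeChar k).contDiffAt (mod_cast le_top)
  rw [h, ← mul_assoc, mul_comm]
  refine (ContinuousLinearMap.norm_compContinuousMultilinearMap_le _ _).trans ?_
  gcongr
  · exact ContinuousLinearMap.opNorm_mul_apply_le ℝ ℂ (b k)
  refine (norm_iteratedFDeriv_latticeChar_le k m x).trans ?_
  gcongr
  simp

theorem RapidDecay.summable_deriv_bound {b : ℤ × ℤ → ℂ} (hb : RapidDecay b) (m : ℕ) :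
    Summable fun k ↦ (2 * Real.pi) ^ m * ((1 + ‖gaussInt k‖) ^ m * ‖b k‖) :=
  (summable_iff_wnorm_ne_top.2 (hb m)).mul_left _

theorem RapidDecay.contDiff_synth {b : ℤ × ℤ → ℂ} (hb : RapidDecay b) : ContDiff ℝ ∞ (synth b) :=
  contDiff_tsum (N := ⊤) (fun k ↦ contDiff_const.mul (contDiff_latticeChar k))
    (fun m _ ↦ hb.summable_deriv_bound m)
    fun m k x _ ↦ norm_iteratedFDeriv_mul_latticeChar_le b m k x

theorem RapidDecay.norm_iteratedFDeriv_synth_le {b : ℤ × ℤ → ℂ} (hb : RapidDecay b) (m : ℕ) (x : ℂ) :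
    ‖iteratedFDeriv ℝ m (synth b) x‖ ≤
      (2 * Real.pi) ^ m * (wnorm (latticeWeight 1 m) b).toReal := by
  have h : iteratedFDeriv ℝ m (synth b) x =
      ∑' k, iteratedFDeriv ℝ m (fun y ↦ b k * latticeChar k y) x :=
    iteratedFDeriv_tsum_apply (N := ⊤) (fun k ↦ contDiff_const.mul (contDiff_latticeChar k))
      (fun m _ ↦ hb.summable_deriv_bound m)
      (fun m k x _ ↦ norm_iteratedFDeriv_mul_latticeChar_le b m k x) (by simp) x
  rw [h, toReal_wnorm, ← tsum_mul_left]
  exact tsum_of_norm_bounded (hb.summable_deriv_bound m).hasSum fun k ↦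
    norm_iteratedFDeriv_mul_latticeChar_le b m k x

theorem RapidDecay.summable {b : ℤ × ℤ → ℂ} (hb : RapidDecay b) : Summable fun k ↦ ‖b k‖ := by
  simpa using summable_iff_wnorm_ne_top.2 (hb 0)

theorem RapidDecay.summable_synth {b : ℤ × ℤ → ℂ} (hb : RapidDecay b) (x : ℂ) :
    Summable fun k ↦ b k * latticeChar k x :=
  .of_norm (by simpa [norm_latticeChar] using hb.summable)

theorem RapidDecay.norm_synth_le {b : ℤ × ℤ → ℂ} (hb : RapidDecay b) (x : ℂ) :
    ‖synth b x‖ ≤ (wnorm (latticeWeight 1 0) b).toReal := by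
  simpa using hb.norm_iteratedFDeriv_synth_le 0 x

theorem RapidDecay.synth_sub {b c : ℤ × ℤ → ℂ} (hb : RapidDecay b) (hc : RapidDecay c) :
    synth (fun k ↦ b k - c k) = synth b - synth c := by
  ext x
  simp only [synth, sub_mul, Pi.sub_apply]
  exact (hb.summable_synth x).tsum_sub (hc.summable_synth x)

theorem RapidDecay.fderiv_synth {b : ℤ × ℤ → ℂ} (hb : RapidDecay b) (x v : ℂ) :
    HasSum (fun k ↦ b k * (2 * Real.pi * I * (inner ℝ (gaussInt k) v : ℝ)) * latticeChar k x)
      (fderiv ℝ (synth b) x v) := by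
  have hd : ∀ k, HasFDerivAt (fun y ↦ b k * latticeChar k y)
      (b k • (innerSL ℝ (gaussInt k)).smulRight (2 * Real.pi * I * latticeChar k x)) x := fun k ↦
    (hasFDerivAt_latticeChar k x).const_mul (b k)
  have hbd : ∀ k x, ‖fderiv ℝ (fun y ↦ b k * latticeChar k y) x‖ ≤
      (2 * Real.pi) ^ 1 * ((1 + ‖gaussInt k‖) ^ 1 * ‖b k‖) := fun k x ↦ by
    have := norm_iteratedFDeriv_mul_latticeChar_le b 1 k x
    rwa [norm_iteratedFDeriv_one] at this
  have h : fderiv ℝ (synth b) x = ∑' k, fderiv ℝ (fun y ↦ b k * latticeChar k y) x :=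
    fderiv_tsum_apply (hb.summable_deriv_bound 1)
      (fun k ↦ (contDiff_const.mul (contDiff_latticeChar k)).differentiable (by simp)) hbd
      (hb.summable_synth 0) x
  have hs : Summable fun k ↦ fderiv ℝ (fun y ↦ b k * latticeChar k y) x :=
    .of_norm_bounded (hb.summable_deriv_bound 1) fun k ↦ hbd k x
  have h2 : HasSum (fun k ↦ fderiv ℝ (fun y ↦ b k * latticeChar k y) x v)
      (fderiv ℝ (synth b) x v) := by
    rw [h]
    exact hs.hasSum.mapL (ContinuousLinearMap.apply ℝ ℂ v)
  have e : (fun k ↦ b k * (2 * Real.pi * I * (inner ℝ (gaussInt k) v : ℝ)) * latticeChar k x) =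
      fun k ↦ fderiv ℝ (fun y ↦ b k * latticeChar k y) x v := by
    ext k
    rw [(hd k).fderiv]
    simp
    ring
  rw [e]
  exact h2

/-- This is the Cauchy product of two absolutely convergent series, reindexed by `(k, l) ↦ (k - l,
l)`. -/
theorem synth_coeffConv {a b : ℤ × ℤ → ℂ} (ha : RapidDecay a) (hb : RapidDecay b) (x : ℂ) :
    synth (coeffConv a b) x = synth a x * synth b x := by
  have h1 : Summable fun p : (ℤ × ℤ) × (ℤ × ℤ) ↦
      (a p.1 * latticeChar p.1 x) * (b p.2 * latticeChar p.2 x) :=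
    summable_mul_of_summable_norm (f := fun k ↦ a k * latticeChar k x)
      (g := fun k ↦ b k * latticeChar k x) (ha.summable_synth x).norm (hb.summable_synth x).norm
  rw [synth, synth, synth, (ha.summable_synth x).tsum_mul_tsum (hb.summable_synth x) h1]
  let e : (ℤ × ℤ) × (ℤ × ℤ) ≃ (ℤ × ℤ) × (ℤ × ℤ) :=
    { toFun := fun p ↦ (p.1 - p.2, p.2)
      invFun := fun p ↦ (p.1 + p.2, p.2)
      left_inv := fun p ↦ by simp
      right_inv := fun p ↦ by simp }
  have h2 : Summable fun p : (ℤ × ℤ) × (ℤ × ℤ) ↦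
      (a (p.1 - p.2) * latticeChar (p.1 - p.2) x) * (b p.2 * latticeChar p.2 x) :=
    e.summable_iff.2 h1
  have h3 := e.tsum_eq fun p : (ℤ × ℤ) × (ℤ × ℤ) ↦
    (a p.1 * latticeChar p.1 x) * (b p.2 * latticeChar p.2 x)
  rw [← h3]
  simp only [e, Equiv.coe_fn_mk]
  rw [h2.tsum_prod]
  refine tsum_congr fun k ↦ ?_
  rw [coeffConv, ← tsum_mul_right]
  refine tsum_congr fun l ↦ ?_
  have : latticeChar k x = latticeChar (k - l) x * latticeChar l x := by
    rw [← latticeChar_add, sub_add_cancel]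
  rw [this]
  ring

/-- The weighted norm of order `m` controls the derivative of order `m` uniformly on the plane, with
constant `(2π)^m`. -/
theorem CTendstoAt.synth {ι : Type*} {l : Filter ι} {b : ι → ℤ × ℤ → ℂ} {b₀ : ℤ × ℤ → ℂ}
    (hb : ∀ i, RapidDecay (b i)) (hb₀ : RapidDecay b₀)
    (h : ∀ s, Tendsto (fun i ↦ wnorm (latticeWeight 1 s) (fun k ↦ b i k - b₀ k)) l (𝓝 0))
    (N : ℕ) (x : ℂ) : CTendstoAt N l (fun i ↦ synth (b i)) (_root_.synth b₀) x := by
  have h1 : CTendstoAt N l (fun i ↦ _root_.synth fun k ↦ b i k - b₀ k) (fun _ ↦ 0) x := by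
    refine ⟨.of_forall fun p ↦ ((hb _).sub hb₀).contDiff_synth.contDiffAt.of_le (mod_cast le_top),
      contDiffAt_const, fun m hm ↦ ?_⟩
    rw [iteratedFDeriv_fun_zero, Pi.zero_apply]
    have h2 : Tendsto (fun p : ι × ℂ ↦ (2 * Real.pi) ^ m *
        (wnorm (latticeWeight 1 m) (fun k ↦ b p.1 k - b₀ k)).toReal) (l ×ˢ 𝓝 x) (𝓝 0) := by
      have h3 := (ENNReal.tendsto_toReal ENNReal.zero_ne_top).comp (h m)
      simpa using (h3.comp tendsto_fst).const_mul ((2 * Real.pi) ^ m)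
    exact squeeze_zero_norm (fun p ↦ ((hb _).sub hb₀).norm_iteratedFDeriv_synth_le m p.2) h2
  have h2 := h1.add (.const (l := l) (hb₀.contDiff_synth.contDiffAt.of_le (mod_cast le_top)))
  simpa [(hb _).synth_sub hb₀] using h2

end FourierSynthesis

/-! ### The Beltrami equation on the torus. -/

section Beltrami

open scoped ENNReal NNReal ComplexConjugate
open Complex (I)

/-- The Fourier multiplier `∂ ∘ (∂bar)⁻¹` on the torus. -/
noncomputable def beurlingSymbol (k : ℤ × ℤ) : ℂ := conj (gaussInt k) / gaussInt k

/-- The Fourier multiplier `(∂bar)⁻¹` on the torus. -/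
noncomputable def cauchySymbol (k : ℤ × ℤ) : ℂ := (Real.pi * I * gaussInt k)⁻¹

theorem norm_beurlingSymbol_le (k : ℤ × ℤ) : ‖beurlingSymbol k‖ ≤ 1 := by
  rw [beurlingSymbol, norm_div, Complex.norm_conj]
  -- This covers `k = 0`, where the symbol is `0 / 0 = 0`.
  exact div_self_le_one _

theorem gaussInt_eq_zero {k : ℤ × ℤ} : gaussInt k = 0 ↔ k = 0 := by
  simp [gaussInt, Complex.ext_iff, Prod.ext_iff]

theorem one_le_norm_gaussInt {k : ℤ × ℤ} (hk : k ≠ 0) : 1 ≤ ‖gaussInt k‖ := by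
  have h : k.1 ≠ 0 ∨ k.2 ≠ 0 := by
    by_contra! h
    exact hk (Prod.ext h.1 h.2)
  rcases h with h | h
  · refine le_trans ?_ (Complex.abs_re_le_norm _)
    simp only [gaussInt]
    exact_mod_cast Int.one_le_abs h
  · refine le_trans ?_ (Complex.abs_im_le_norm _)
    simp only [gaussInt]
    exact_mod_cast Int.one_le_abs h

theorem norm_cauchySymbol_le (k : ℤ × ℤ) : ‖cauchySymbol k‖ ≤ 1 := by
  -- At `k = 0` the symbol is `0⁻¹ = 0`: the mean value is discarded.
  rcases eq_or_ne k 0 with rfl | hk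
  · simp [cauchySymbol, gaussInt_eq_zero.2]
  · rw [cauchySymbol, norm_inv, norm_mul, norm_mul, Complex.norm_I, mul_one, Complex.norm_real,
      Real.norm_of_nonneg Real.pi_pos.le]
    refine inv_le_one_of_one_le₀ ?_
    nlinarith [Real.pi_gt_three, one_le_norm_gaussInt hk]

/-- The coefficients of `∂bar f` for the solution `f` of the Beltrami equation. -/
noncomputable def beltramiCoeff (a : ℤ × ℤ → ℂ) : ℤ × ℤ → ℂ := neumannSol a beurlingSymbol

/-- The solution, vanishing at the origin, of the Beltrami equation on the torus whose coefficient
has the Fourier coefficients `a`. -/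
noncomputable def beltramiMap (a : ℤ × ℤ → ℂ) (x : ℂ) : ℂ :=
  x + beltramiCoeff a 0 * conj x + synth (fun k ↦ cauchySymbol k * beltramiCoeff a k) x -
    synth (fun k ↦ cauchySymbol k * beltramiCoeff a k) 0

theorem beltramiMap_zero (a : ℤ × ℤ → ℂ) : beltramiMap a 0 = 0 := by simp [beltramiMap]

variable {a : ℤ × ℤ → ℂ}

theorem RapidDecay.beltramiCoeff (ha : RapidDecay a) (h : wnorm (latticeWeight 1 0) a < 1 / 8) :
    RapidDecay (beltramiCoeff a) := fun s ↦
  wnorm_latticeWeight_neumannSol_ne_top norm_beurlingSymbol_le (ha s) (h.trans (by norm_num))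

theorem wnorm_beltramiCoeff_le (h : wnorm (latticeWeight 1 0) a < 1 / 8) :
    (wnorm (latticeWeight 1 0) (beltramiCoeff a)).toReal ≤ 1 / 4 := by
  have h1 : wnorm (latticeWeight 1 0) (beltramiCoeff a) ≤ ENNReal.ofReal (1 / 4) := by
    refine ((isCoeffWeight_latticeWeight 1 0).wnorm_neumannSol_le norm_beurlingSymbol_le).trans ?_
    have h2 : (1 : ℝ≥0∞) / 8 = ENNReal.ofReal (1 / 8) := by
      rw [ENNReal.ofReal_div_of_pos (by norm_num)]; simp
    rw [h2] at h
    calc _ ≤ ENNReal.ofReal (1 / 8) * (1 - ENNReal.ofReal (1 / 8))⁻¹ := by gcongr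
      _ = ENNReal.ofReal (1 / 8 * (1 - 1 / 8)⁻¹) := by
        rw [← ENNReal.ofReal_one, ← ENNReal.ofReal_sub _ (by norm_num),
          ← ENNReal.ofReal_inv_of_pos (by norm_num), ← ENNReal.ofReal_mul (by norm_num)]
      -- The geometric series gives `(1/8) / (7/8) = 1/7 ≤ 1/4`.
      _ ≤ _ := ENNReal.ofReal_le_ofReal (by norm_num)
  exact ENNReal.toReal_le_of_le_ofReal (by norm_num) h1

/-- The function `∂ f - 1` for the solution `f` of the Beltrami equation. -/
noncomputable def beltramiDz (a : ℤ × ℤ → ℂ) : ℂ → ℂ :=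
  synth fun k ↦ beurlingSymbol k * beltramiCoeff a k

theorem norm_synth_beltramiCoeff_le (ha : RapidDecay a)
    (h : wnorm (latticeWeight 1 0) a < 1 / 8) (x : ℂ) : ‖synth (beltramiCoeff a) x‖ ≤ 1 / 4 :=
  ((ha.beltramiCoeff h).norm_synth_le x).trans (wnorm_beltramiCoeff_le h)

theorem norm_beltramiDz_le (ha : RapidDecay a)
    (h : wnorm (latticeWeight 1 0) a < 1 / 8) (x : ℂ) : ‖beltramiDz a x‖ ≤ 1 / 4 := by
  refine (((ha.beltramiCoeff h).mul_of_norm_le_one norm_beurlingSymbol_le).norm_synth_le x).trans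
    (le_trans ?_ (wnorm_beltramiCoeff_le h))
  exact ENNReal.toReal_mono (ha.beltramiCoeff h 0) (wnorm_mul_le norm_beurlingSymbol_le _)

/-- The Beltrami equation. -/
theorem synth_beltramiCoeff (ha : RapidDecay a) (h : wnorm (latticeWeight 1 0) a < 1 / 8) (x : ℂ) :
    synth (beltramiCoeff a) x = synth a x * (1 + beltramiDz a x) := by
  have hm := (ha.beltramiCoeff h).mul_of_norm_le_one norm_beurlingSymbol_le
  have h1 : RapidDecay (coeffConv a fun k ↦ beurlingSymbol k * beltramiCoeff a k) := fun s ↦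
    ne_top_of_le_ne_top (ENNReal.mul_ne_top (ha s) (hm s))
      ((isCoeffWeight_latticeWeight 1 s).wnorm_conv_le _ _)
  rw [mul_add, mul_one, beltramiDz, ← synth_coeffConv ha hm]
  simp only [synth]
  rw [← (ha.summable_synth x).tsum_add (h1.summable_synth x)]
  refine tsum_congr fun k ↦ ?_
  -- The fixed-point equation of the Neumann series is the Beltrami equation on the level of Fourier
  -- coefficients.
  have h2 : beltramiCoeff a k = a k + coeffConv a (fun k ↦ beurlingSymbol k * beltramiCoeff a k) k :=
    (isCoeffWeight_latticeWeight 1 0).neumannSol_eq norm_beurlingSymbol_le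
      (h.trans (by norm_num)) k
  rw [← add_mul, ← h2]

/-- Since `⟨k, v⟩ = (conj k * v + k * conj v) / 2`, differentiating a character multiplies it by `πi
conj k` in the `∂` direction and by `πi k` in the `∂bar` direction; dividing by `πi k` leaves `conj
k / k` and `1`. -/
theorem cauchySymbol_mul_inner (k : ℤ × ℤ) (v : ℂ) :
    cauchySymbol k * (2 * Real.pi * I * (inner ℝ (gaussInt k) v : ℝ)) =
      beurlingSymbol k * v + (if k = 0 then 0 else conj v) := by
  rcases eq_or_ne k 0 with rfl | hk
  · simp [cauchySymbol, beurlingSymbol, gaussInt_eq_zero.2]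
  · have h0 : gaussInt k ≠ 0 := fun h ↦ hk (gaussInt_eq_zero.1 h)
    have h1 : ((inner ℝ (gaussInt k) v : ℝ) : ℂ) =
        (conj (gaussInt k) * v + gaussInt k * conj v) / 2 := by
      apply Complex.ext <;> simp [Complex.inner] <;> ring
    have h2 : (Real.pi : ℂ) ≠ 0 := by exact_mod_cast Real.pi_ne_zero
    rw [if_neg hk, h1, cauchySymbol, beurlingSymbol]
    field_simp [Complex.I_ne_zero]

theorem contDiff_beltramiMap (ha : RapidDecay a) (h : wnorm (latticeWeight 1 0) a < 1 / 8) :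
    ContDiff ℝ ∞ (beltramiMap a) := by
  have h1 := ((ha.beltramiCoeff h).mul_of_norm_le_one norm_cauchySymbol_le).contDiff_synth
  exact ((contDiff_id.add (contDiff_const.mul Complex.conjCLE.contDiff)).add h1).sub contDiff_const

/-- The periodic part of `f` has `∂bar` derivative equal to `synth (beltramiCoeff a)` minus its
mean, because `cauchySymbol` vanishes at `0`; the term `beltramiCoeff a 0 * conj x` restores the
mean. Thus `∂f = 1 + beltramiDz a` and `∂bar f = synth (beltramiCoeff a)`. -/
theorem hasFDerivAt_beltramiMap (ha : RapidDecay a) (h : wnorm (latticeWeight 1 0) a < 1 / 8)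
    (x : ℂ) : HasFDerivAt (beltramiMap a) (ContinuousLinearMap.id ℝ ℂ +
      (ContinuousLinearMap.mul ℝ ℂ (beltramiDz a x) +
        (ContinuousLinearMap.mul ℝ ℂ (synth (beltramiCoeff a) x)).comp
          (Complex.conjCLE : ℂ →L[ℝ] ℂ))) x := by
  have hB := ha.beltramiCoeff h
  have hC := hB.mul_of_norm_le_one norm_cauchySymbol_le
  have hM := hB.mul_of_norm_le_one norm_beurlingSymbol_le
  have h1 := (hC.contDiff_synth.differentiable (by simp) x).hasFDerivAt
  have h2 : HasFDerivAt (fun y : ℂ ↦ beltramiCoeff a 0 * conj y)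
      ((ContinuousLinearMap.mul ℝ ℂ (beltramiCoeff a 0)).comp (Complex.conjCLE : ℂ →L[ℝ] ℂ)) x :=
    ((ContinuousLinearMap.mul ℝ ℂ (beltramiCoeff a 0)).comp
      (Complex.conjCLE : ℂ →L[ℝ] ℂ)).hasFDerivAt
  have h3 := (((hasFDerivAt_id x).add h2).add h1).sub_const
    (synth (fun k ↦ cauchySymbol k * beltramiCoeff a k) 0)
  refine h3.congr_fderiv ?_
  refine ContinuousLinearMap.ext fun v ↦ ?_
  have h4 := hC.fderiv_synth x v
  have h5 : HasSum (fun k ↦ beurlingSymbol k * beltramiCoeff a k * latticeChar k x * v +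
      (beltramiCoeff a k * latticeChar k x * conj v - if k = 0 then beltramiCoeff a 0 * conj v else 0))
      (beltramiDz a x * v + (synth (beltramiCoeff a) x * conj v - beltramiCoeff a 0 * conj v)) :=
    ((hM.summable_synth x).hasSum.mul_right v).add
      (((hB.summable_synth x).hasSum.mul_right (conj v)).sub (hasSum_ite_eq 0 _))
  have h6 := h4.unique (h5.congr_fun fun k ↦ ?_)
  · simp [h6]
    ring
  · rw [show cauchySymbol k * beltramiCoeff a k * (2 * Real.pi * I * (inner ℝ (gaussInt k) v : ℝ)) =
      cauchySymbol k * (2 * Real.pi * I * (inner ℝ (gaussInt k) v : ℝ)) * beltramiCoeff a k by ring,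
      cauchySymbol_mul_inner]
    rcases eq_or_ne k 0 with rfl | hk
    · simp [latticeChar_zero]; ring
    · simp [hk]; ring

theorem norm_fderiv_beltramiMap_sub_id_le (ha : RapidDecay a)
    (h : wnorm (latticeWeight 1 0) a < 1 / 8) (x : ℂ) :
    ‖fderiv ℝ (beltramiMap a) x - ContinuousLinearMap.id ℝ ℂ‖ ≤ 1 / 2 := by
  rw [(hasFDerivAt_beltramiMap ha h x).fderiv, add_sub_cancel_left]
  refine ContinuousLinearMap.opNorm_le_bound _ (by norm_num) fun v ↦ ?_
  have h1 := norm_beltramiDz_le ha h x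
  have h2 := norm_synth_beltramiCoeff_le ha h x
  simp only [add_apply, ContinuousLinearMap.mul_apply',
    ContinuousLinearMap.comp_apply, ContinuousLinearEquiv.coe_coe, Complex.conjCLE_apply]
  refine (norm_add_le _ _).trans ?_
  rw [norm_mul, norm_mul, Complex.norm_conj]
  nlinarith [norm_nonneg v]

/-- The map `f - id` is `1/2`-Lipschitz, so `f` is a global homeomorphism by the quantitative
inverse function theorem, and `‖x - y‖ ≤ 2 ‖f x - f y‖`. Each derivative is within distance less
than `1` of the identity, hence invertible, which makes the inverse smooth. -/
theorem exists_homeomorph_of_fderiv_sub_id_le {E : Type*} [NormedAddCommGroup E] [NormedSpace ℝ E]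
    [CompleteSpace E] {f : E → E} (hf : ContDiff ℝ ∞ f)
    (h : ∀ x, ‖fderiv ℝ f x - ContinuousLinearMap.id ℝ E‖ ≤ 1 / 2) :
    ∃ e : E ≃ₜ E, ⇑e = f ∧ ContDiff ℝ ∞ e.symm ∧ LipschitzWith 2 e.symm := by
  have hd : Differentiable ℝ f := hf.differentiable (by simp)
  have hL : LipschitzWith (1 / 2) (f - id) := by
    refine lipschitzWith_of_nnnorm_fderiv_le (𝕜 := ℝ) (hd.sub differentiable_id) fun x ↦ ?_
    rw [fderiv_sub (hd x) differentiableAt_id, fderiv_id]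
    exact_mod_cast h x
  have hA : ApproximatesLinearOn f ((ContinuousLinearEquiv.refl ℝ E : E ≃L[ℝ] E) : E →L[ℝ] E) univ
      (1 / 2) := by
    rw [ApproximatesLinearOn.approximatesLinearOn_iff_lipschitzOnWith, lipschitzOnWith_univ]
    exact hL
  have hc : Subsingleton E ∨ (1 / 2 : ℝ≥0) <
      ‖((ContinuousLinearEquiv.refl ℝ E).symm : E →L[ℝ] E)‖₊⁻¹ := by
    rcases subsingleton_or_nontrivial E with h | h
    · exact .inl h
    · right
      have : ‖((ContinuousLinearEquiv.refl ℝ E).symm : E →L[ℝ] E)‖₊ = 1 := by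
        ext
        exact ContinuousLinearMap.norm_id
      rw [this]
      norm_num
  let e := hA.toHomeomorph f hc
  have he : ⇑e = f := rfl
  refine ⟨e, he, ?_, ?_⟩
  · have hu : ∀ x, ∃ A : E ≃L[ℝ] E, (A : E →L[ℝ] E) = fderiv ℝ f x := fun x ↦ by
      have h1 : ‖ContinuousLinearMap.id ℝ E - fderiv ℝ f x‖ < 1 := by
        rw [norm_sub_rev]
        exact (h x).trans_lt (by norm_num)
      refine ⟨ContinuousLinearEquiv.unitsEquiv ℝ E (Units.oneSub _ h1), ?_⟩
      ext v
      simp [ContinuousLinearMap.one_def]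
    choose A hA using hu
    refine e.contDiff_symm (f₀' := A) (fun x ↦ ?_) (he ▸ hf)
    rw [he, hA]
    exact (hd x).hasFDerivAt
  · refine LipschitzWith.of_dist_le_mul fun x y ↦ ?_
    have h1 := hL.dist_le_mul (e.symm x) (e.symm y)
    have h2 : ∀ x, f (e.symm x) = x := fun x ↦ by rw [← he]; exact e.apply_symm_apply x
    simp only [Pi.sub_apply, h2, id, dist_eq_norm] at h1 ⊢
    have h3 : e.symm x - e.symm y = (x - y) - (x - e.symm x - (y - e.symm y)) := by abel
    have h4 := norm_sub_le (x - y) (x - e.symm x - (y - e.symm y))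
    rw [← h3] at h4
    push_cast at h1 ⊢
    linarith

theorem exists_beltramiMap_homeomorph (ha : RapidDecay a)
    (h : wnorm (latticeWeight 1 0) a < 1 / 8) :
    ∃ e : ℂ ≃ₜ ℂ, ⇑e = beltramiMap a ∧ ContDiff ℝ ∞ e.symm ∧ LipschitzWith 2 e.symm :=
  exists_homeomorph_of_fderiv_sub_id_le (contDiff_beltramiMap ha h)
    (norm_fderiv_beltramiMap_sub_id_le ha h)

theorem CTendstoAt.beltramiMap {ι : Type*} {l : Filter ι} {b : ι → ℤ × ℤ → ℂ} {b₀ : ℤ × ℤ → ℂ}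
    (hb : ∀ i, RapidDecay (b i)) (hb₀ : RapidDecay b₀)
    (hs : ∀ i, wnorm (latticeWeight 1 0) (b i) < 1 / 8)
    (hs₀ : wnorm (latticeWeight 1 0) b₀ < 1 / 8)
    (h : ∀ s, Tendsto (fun i ↦ wnorm (latticeWeight 1 s) (fun k ↦ b i k - b₀ k)) l (𝓝 0))
    (N : ℕ) (x : ℂ) : CTendstoAt N l (fun i ↦ beltramiMap (b i)) (_root_.beltramiMap b₀) x := by
  have h1 : ∀ s, Tendsto (fun i ↦ wnorm (latticeWeight 1 s)
      (fun k ↦ beltramiCoeff (b i) k - beltramiCoeff b₀ k)) l (𝓝 0) := fun s ↦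
    tendsto_wnorm_neumannSol_sub norm_beurlingSymbol_le (hb₀ s) (hs₀.trans_le
      (ENNReal.div_le_div_left (by norm_num) 1)) (h s)
  have hC : ∀ {c}, RapidDecay c → wnorm (latticeWeight 1 0) c < 1 / 8 →
      RapidDecay fun k ↦ cauchySymbol k * beltramiCoeff c k := fun hc hc' ↦
    (hc.beltramiCoeff hc').mul_of_norm_le_one norm_cauchySymbol_le
  have h2 : ∀ s, Tendsto (fun i ↦ wnorm (latticeWeight 1 s)
      (fun k ↦ cauchySymbol k * beltramiCoeff (b i) k - cauchySymbol k * beltramiCoeff b₀ k)) l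
      (𝓝 0) := fun s ↦ by
    refine tendsto_of_tendsto_of_tendsto_of_le_of_le tendsto_const_nhds (h1 s)
      (fun _ ↦ zero_le) fun i ↦ ?_
    simp only [← mul_sub]
    exact wnorm_mul_le norm_cauchySymbol_le _
  have h3 := fun x ↦ CTendstoAt.synth (fun i ↦ hC (hb i) (hs i)) (hC hb₀ hs₀) h2 N x
  have h4 : Tendsto (fun i ↦ beltramiCoeff (b i) 0) l (𝓝 (beltramiCoeff b₀ 0)) := by
    rw [tendsto_iff_edist_tendsto_0]
    refine tendsto_of_tendsto_of_tendsto_of_le_of_le tendsto_const_nhds (h1 0)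
      (fun _ ↦ zero_le) fun i ↦ ?_
    rw [edist_eq_enorm_sub]
    refine le_trans ?_ (ENNReal.le_tsum 0)
    simp [latticeWeight]
  have h5 : Tendsto (fun i ↦ -_root_.synth (fun k ↦ cauchySymbol k * beltramiCoeff (b i) k) 0) l
      (𝓝 (-_root_.synth (fun k ↦ cauchySymbol k * beltramiCoeff b₀ k) 0)) := by
    have := (h3 0).tendsto_zero.comp (tendsto_id.prodMk (tendsto_const_nhds (x := (0 : ℂ))))
    exact this.neg
  have h6 : CTendstoAt N l (fun i x ↦ beltramiCoeff (b i) 0 * conj x)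
      (fun x ↦ beltramiCoeff b₀ 0 * conj x) x := by
    have h7 := (CTendstoAt.of_tendsto h4).prodMk (.const (l := l) (x := x) (N := N)
      Complex.conjCLE.contDiff.contDiffAt)
    exact h7.comp_left (g := fun p : ℂ × ℂ ↦ p.1 * p.2) (contDiff_mul.contDiffAt)
  have h8 := (((CTendstoAt.const (l := l) (x := x) (N := N) contDiff_id.contDiffAt).add h6).add
    (h3 x)).add (.of_tendsto h5)
  refine h8.congr (.of_forall fun p ↦ .of_forall fun y ↦ ?_) (.of_forall fun y ↦ ?_) <;>
    simp [_root_.beltramiMap, sub_eq_add_neg]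

end Beltrami

/-! ### Fourier coefficients of smooth functions with small support. -/

section FourierExpansion

open scoped ENNReal NNReal ComplexConjugate SchwartzMap FourierTransform
open Complex (I)

theorem summable_int_inv_sq : Summable fun n : ℤ ↦ ((1 + |(n : ℝ)|) ^ 2)⁻¹ := by
  have h : Summable fun n : ℕ ↦ ((1 + |(n : ℝ)|) ^ 2)⁻¹ := by
    have := (summable_nat_add_iff 1).2 (Real.summable_nat_pow_inv.2 one_lt_two)
    refine this.congr fun n ↦ ?_
    rw [abs_of_nonneg (by positivity)]
    push_cast
    ring
  exact .of_nat_of_neg (by simpa using h) (by simpa using h)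

theorem summable_gaussInt_inv : Summable fun k : ℤ × ℤ ↦ ((1 + ‖gaussInt k‖) ^ 4)⁻¹ := by
  have h := summable_int_inv_sq.mul_of_nonneg summable_int_inv_sq (fun n ↦ by positivity)
    (fun n ↦ by positivity)
  refine .of_nonneg_of_le (fun k ↦ by positivity) (fun k ↦ ?_) h
  rw [← mul_inv]
  gcongr
  have h1 : |(k.1 : ℝ)| ≤ ‖gaussInt k‖ := Complex.abs_re_le_norm (gaussInt k)
  have h2 : |(k.2 : ℝ)| ≤ ‖gaussInt k‖ := Complex.abs_im_le_norm (gaussInt k)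
  calc (1 + |(k.1 : ℝ)|) ^ 2 * (1 + |(k.2 : ℝ)|) ^ 2 ≤ (1 + ‖gaussInt k‖) ^ 2 * (1 + ‖gaussInt k‖) ^ 2 := by
        gcongr
    _ = _ := by ring

/-- The values of the Fourier transform at the Gaussian integers. -/
noncomputable def schwartzCoeff (u : 𝓢(ℂ, ℂ)) (k : ℤ × ℤ) : ℂ := 𝓕 u (gaussInt k)

/-- The seminorm controlling the decay of order `s + 4` of the Fourier transform. -/
noncomputable def fourierDecay (s : ℕ) (u : 𝓢(ℂ, ℂ)) : ℝ :=
  2 ^ (s + 4) * (Finset.Iic (s + 4, 0)).sup (schwartzSeminormFamily ℝ ℂ ℂ) (𝓕 u)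

/-- Four powers of decay beyond `s` pay for the summation, as `(1 + |k|)⁻⁴` is summable over the
lattice. -/
theorem wnorm_schwartzCoeff_le (s : ℕ) (u : 𝓢(ℂ, ℂ)) :
    wnorm (latticeWeight 1 s) (schwartzCoeff u) ≤
      ENNReal.ofReal (fourierDecay s u) * ∑' k, ENNReal.ofReal ((1 + ‖gaussInt k‖) ^ 4)⁻¹ := by
  rw [wnorm, ← ENNReal.tsum_mul_left]
  refine ENNReal.tsum_le_tsum fun k ↦ ?_
  have h := SchwartzMap.one_add_le_sup_seminorm_apply (𝕜 := ℝ) (m := (s + 4, 0)) (k := s + 4)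
    (n := 0) le_rfl le_rfl (𝓕 u) (gaussInt k)
  rw [norm_iteratedFDeriv_zero] at h
  rw [enorm_latticeWeight, Real.enorm_of_nonneg (by positivity),
    ← ENNReal.ofReal_mul (by unfold fourierDecay; positivity)]
  refine ENNReal.ofReal_le_ofReal ?_
  rw [← div_eq_mul_inv, le_div_iff₀ (by positivity)]
  refine le_trans (le_of_eq ?_) h
  rw [schwartzCoeff, pow_add]
  ring

theorem tsum_gaussInt_ne_top : ∑' k, ENNReal.ofReal ((1 + ‖gaussInt k‖) ^ 4)⁻¹ ≠ ⊤ := by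
  have := summable_gaussInt_inv
  rw [← ENNReal.ofReal_tsum_of_nonneg (fun k ↦ by positivity) this]
  exact ENNReal.ofReal_ne_top

theorem rapidDecay_schwartzCoeff (u : 𝓢(ℂ, ℂ)) : RapidDecay (schwartzCoeff u) := fun s ↦
  ne_top_of_le_ne_top (ENNReal.mul_ne_top ENNReal.ofReal_ne_top tsum_gaussInt_ne_top)
    (wnorm_schwartzCoeff_le s u)

theorem tendsto_wnorm_schwartzCoeff_sub {ι : Type*} {l : Filter ι} {u : ι → 𝓢(ℂ, ℂ)} {u₀ : 𝓢(ℂ, ℂ)}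
    (h : Tendsto u l (𝓝 u₀)) (s : ℕ) :
    Tendsto (fun i ↦ wnorm (latticeWeight 1 s) fun k ↦ schwartzCoeff (u i) k - schwartzCoeff u₀ k) l
      (𝓝 0) := by
  have hsub : ∀ i, 𝓕 (u i - u₀) = 𝓕 (u i) - 𝓕 u₀ := fun i ↦
    map_sub (FourierTransform.fourierCLM ℂ 𝓢(ℂ, ℂ)) _ _
  have h1 : Tendsto (fun i ↦ fourierDecay s (u i - u₀)) l (𝓝 0) := by
    have h2 : Tendsto (fun i ↦ 𝓕 (u i)) l (𝓝 (𝓕 u₀)) :=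
      ((FourierTransform.fourierCLM ℂ 𝓢(ℂ, ℂ)).continuous.tendsto u₀).comp h
    have h3 : Tendsto (fun i ↦ (Finset.Iic (s + 4, 0)).sup (schwartzSeminormFamily ℝ ℂ ℂ)
        (𝓕 (u i - u₀))) l (𝓝 0) := by
      rw [Metric.tendsto_nhds]
      intro ε hε
      filter_upwards [((schwartz_withSeminorms ℝ ℂ ℂ).tendsto_nhds' _ _).1 h2
        (Finset.Iic (s + 4, 0)) ε hε] with i hi
      rwa [hsub, Real.dist_eq, sub_zero, abs_of_nonneg (apply_nonneg _ _)]
    simpa [fourierDecay] using h3.const_mul (2 ^ (s + 4))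
  have h4 := ENNReal.Tendsto.mul_const (b := ∑' k, ENNReal.ofReal ((1 + ‖gaussInt k‖) ^ 4)⁻¹)
    (ENNReal.tendsto_ofReal h1) (.inr tsum_gaussInt_ne_top)
  rw [ENNReal.ofReal_zero, zero_mul] at h4
  refine tendsto_of_tendsto_of_tendsto_of_le_of_le tendsto_const_nhds h4 (fun _ ↦ zero_le) fun i ↦ ?_
  have h5 : (fun k ↦ schwartzCoeff (u i) k - schwartzCoeff u₀ k) = schwartzCoeff (u i - u₀) := by
    ext k
    simp [schwartzCoeff, hsub]
  rw [h5]
  exact wnorm_schwartzCoeff_le s _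

/-- A family of smooth functions supported in a fixed compact set converges in the Schwartz space if
it converges locally uniformly together with all derivatives. -/
theorem tendsto_schwartzMap_of_cTendstoAt {ι : Type*} {l : Filter ι} {u : ι → 𝓢(ℂ, ℂ)}
    {u₀ : 𝓢(ℂ, ℂ)} {K : Set ℂ} (hK : IsCompact K) (hu : ∀ i, ∀ x ∉ K, u i x = 0)
    (hu₀ : ∀ x ∉ K, u₀ x = 0) (h : ∀ N, ∀ x ∈ K, CTendstoAt N l (fun i ↦ u i) u₀ x) :
    Tendsto u l (𝓝 u₀) := by
  rw [(schwartz_withSeminorms ℝ ℂ ℂ).tendsto_nhds]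
  rintro ⟨k, n⟩ ε hε
  obtain ⟨R, hR⟩ := hK.isBounded.exists_norm_le
  have hR' : ∀ x ∈ K, ‖x‖ ^ k ≤ |R| ^ k := fun x hx ↦ by
    gcongr
    exact (hR x hx).trans (le_abs_self R)
  have hU : TendstoUniformlyOn (fun i ↦ iteratedFDeriv ℝ n (u i)) (iteratedFDeriv ℝ n u₀) l K :=
    hK.tendstoUniformlyOn_of_prod (fun x hx ↦ (h n x hx).tendsto n le_rfl)
      fun x _ ↦ ((u₀.smooth n).continuous_iteratedFDeriv le_rfl).continuousAt
  rw [Metric.tendstoUniformlyOn_iff] at hU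
  filter_upwards [hU (ε / (2 * (|R| ^ k + 1))) (by positivity)] with i hi
  refine lt_of_le_of_lt (SchwartzMap.seminorm_le_bound ℝ k n _ (M := ε / 2) (by positivity)
    fun x ↦ ?_) (by linarith)
  have e : iteratedFDeriv ℝ n (⇑(u i - u₀)) x = iteratedFDeriv ℝ n (u i) x - iteratedFDeriv ℝ n u₀ x :=
    iteratedFDeriv_sub_apply ((u i).smooth n).contDiffAt (u₀.smooth n).contDiffAt
  by_cases hx : x ∈ K
  · rw [e, ← dist_eq_norm, dist_comm]
    calc ‖x‖ ^ k * dist (iteratedFDeriv ℝ n u₀ x) (iteratedFDeriv ℝ n (u i) x)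
        ≤ |R| ^ k * (ε / (2 * (|R| ^ k + 1))) :=
          mul_le_mul (hR' x hx) (hi x hx).le dist_nonneg (by positivity)
      _ ≤ ε / 2 := by
        rw [mul_div_assoc', div_le_div_iff₀ (by positivity) (by positivity)]
        nlinarith [pow_nonneg (abs_nonneg R) k]
  -- Off the closed set `K` both functions vanish on a whole neighbourhood, hence so do the
  -- derivatives.
  · have h0 : ⇑(u i - u₀) =ᶠ[𝓝 x] fun _ ↦ 0 := by
      filter_upwards [hK.isClosed.isOpen_compl.mem_nhds hx] with y hy
      simp [hu i y hy, hu₀ y hy]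
    rw [(EventuallyEq.iteratedFDeriv ℝ h0 n).eq_of_nhds, iteratedFDeriv_fun_zero]
    simp
    positivity

instance : Fact ((0 : ℝ) < 1) := ⟨one_pos⟩

/-- The representative of a point of the torus in the square `(-1/2, 1/2]²`, as a complex number. -/
noncomputable def torusRep (t : UnitAddTorus (Fin 2)) : ℂ :=
  ((AddCircle.equivIoc (1 : ℝ) (-1 / 2) (t 0) : ℝ) : ℂ) +
    ((AddCircle.equivIoc (1 : ℝ) (-1 / 2) (t 1) : ℝ) : ℂ) * I

theorem torusRep_coe {x : Fin 2 → ℝ} (hx : ∀ i, x i ∈ Ioc (-1 / 2 : ℝ) (-1 / 2 + 1)) :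
    torusRep (fun i ↦ (x i : UnitAddCircle)) = x 0 + x 1 * I := by
  rw [torusRep, AddCircle.equivIoc_coe_eq (hx 0), AddCircle.equivIoc_coe_eq (hx 1)]

/-- The representative jumps only along the seams of the square. On the compact image of `[-1/4,
1/4]²` it is continuous, and on the open complement of that image the composite is zero. -/
theorem continuous_comp_torusRep {u : ℂ → ℂ} (hu : Continuous u) (h : ∀ x, 1 / 4 ≤ ‖x‖ → u x = 0) :
    Continuous fun t ↦ u (torusRep t) := by
  let Q : Set (Fin 2 → ℝ) := univ.pi fun _ ↦ Icc (-1 / 4) (1 / 4)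
  let q : (Fin 2 → ℝ) → UnitAddTorus (Fin 2) := fun x i ↦ (x i : UnitAddCircle)
  have hq : Continuous q := by
    refine continuous_pi fun i ↦ ?_
    exact (AddCircle.continuous_mk' 1).comp (continuous_apply i)
  have hQ : IsClosed (q '' Q) :=
    ((isCompact_univ_pi fun _ ↦ isCompact_Icc).image hq).isClosed
  rw [continuous_iff_continuousAt]
  intro t
  by_cases ht : t ∈ q '' Q
  · obtain ⟨x, hx, rfl⟩ := ht
    refine hu.continuousAt.comp ?_
    have hc : ∀ i, ContinuousAt (fun t : UnitAddTorus (Fin 2) ↦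
        ((AddCircle.equivIoc (1 : ℝ) (-1 / 2) (t i) : ℝ) : ℂ)) (q x) := fun i ↦ by
      have hx' := hx i (mem_univ i)
      have hne : (x i : UnitAddCircle) ≠ ((-1 / 2 : ℝ) : UnitAddCircle) := fun he ↦ by
        rw [show ((-1 / 2 : ℝ) : UnitAddCircle) = ((1 / 2 : ℝ) : UnitAddCircle) by
          rw [show (1 / 2 : ℝ) = -1 / 2 + 1 by norm_num, AddCircle.coe_add_period]] at he
        have := (AddCircle.coe_eq_coe_iff_of_mem_Ioc (p := (1 : ℝ)) (a := -1 / 2)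
          (by constructor <;> linarith [hx'.1, hx'.2]) (by norm_num)).1 he
        linarith [hx'.2]
      exact (Complex.continuous_ofReal.comp continuous_subtype_val).continuousAt.comp
        (ContinuousAt.comp (f := fun t : UnitAddTorus (Fin 2) ↦ t i) (x := q x)
          (AddCircle.continuousAt_equivIoc (1 : ℝ) (-1 / 2) hne) (continuous_apply i).continuousAt)
    exact (hc 0).add ((hc 1).mul continuousAt_const)
  · have h0 : (fun t ↦ u (torusRep t)) =ᶠ[𝓝 t] fun _ ↦ 0 := by
      filter_upwards [hQ.isOpen_compl.mem_nhds ht] with s hs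
      by_contra hne
      refine hs ⟨![AddCircle.equivIoc (1 : ℝ) (-1 / 2) (s 0), AddCircle.equivIoc (1 : ℝ) (-1 / 2) (s 1)],
        ?_, ?_⟩
      · have hlt : ‖torusRep s‖ < 1 / 4 := by
          by_contra hge
          exact hne (h _ (not_lt.1 hge))
        have hre := (Complex.abs_re_le_norm (torusRep s)).trans hlt.le
        have him := (Complex.abs_im_le_norm (torusRep s)).trans hlt.le
        simp only [torusRep, Complex.add_re, Complex.ofReal_re, Complex.mul_re, Complex.I_re,
          Complex.ofReal_im, Complex.I_im, Complex.add_im, Complex.mul_im, mul_zero,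
          mul_one, sub_zero, add_zero, zero_add] at hre him
        rw [abs_le] at hre him
        intro i _
        fin_cases i
        · exact ⟨by simpa [neg_div] using hre.1, hre.2⟩
        · exact ⟨by simpa [neg_div] using him.1, him.2⟩
      · ext i
        fin_cases i
        · exact AddCircle.coe_equivIoc
        · exact AddCircle.coe_equivIoc
    exact continuousAt_const.congr h0.symm

/-- The support lies inside the fundamental square, so the integral over the square is the integral
over the plane that defines the Fourier transform. -/
theorem mFourierCoeff_comp_torusRep {u : 𝓢(ℂ, ℂ)} (h : ∀ x, 1 / 4 ≤ ‖x‖ → u x = 0)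
    (n : Fin 2 → ℤ) :
    UnitAddTorus.mFourierCoeff (fun t ↦ u (torusRep t)) n = schwartzCoeff u (n 0, n 1) := by
  let g : (Fin 2 → ℝ) → ℂ := fun x ↦
    Complex.exp (((-2 * Real.pi * (n 0 * x 0 + n 1 * x 1) : ℝ) : ℂ) * I) * u (x 0 + x 1 * I)
  have h1 : UnitAddTorus.mFourierCoeff (fun t ↦ u (torusRep t)) n =
      ∫ x in {x : Fin 2 → ℝ | ∀ i, x i ∈ Ioc (-1 / 2 : ℝ) (-1 / 2 + 1)}, g x := by
    rw [UnitAddTorus.mFourierCoeff_eq_integral _ n fun _ ↦ -1 / 2]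
    refine MeasureTheory.setIntegral_congr_fun ?_ fun x hx ↦ ?_
    · exact MeasurableSet.univ_pi' fun i ↦ measurableSet_Ioc
    · simp only [g]
      rw [torusRep_coe hx, smul_eq_mul]
      congr 1
      simp only [UnitAddTorus.mFourier, ContinuousMap.coe_mk, Fin.prod_univ_two, fourier_coe_apply,
        ← Complex.exp_add, Pi.neg_apply]
      congr 1
      push_cast
      ring
  have h2 : ∫ x in {x : Fin 2 → ℝ | ∀ i, x i ∈ Ioc (-1 / 2 : ℝ) (-1 / 2 + 1)}, g x = ∫ x, g x := by
    refine MeasureTheory.setIntegral_eq_integral_of_forall_compl_eq_zero fun x hx ↦ ?_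
    simp only [g]
    rw [h, mul_zero]
    by_contra hlt
    rw [not_le] at hlt
    refine hx fun i ↦ ?_
    have hre := (Complex.abs_re_le_norm ((x 0 : ℂ) + x 1 * I)).trans hlt.le
    have him := (Complex.abs_im_le_norm ((x 0 : ℂ) + x 1 * I)).trans hlt.le
    simp only [Complex.add_re, Complex.ofReal_re, Complex.mul_re, Complex.I_re,
      Complex.ofReal_im, Complex.I_im, Complex.add_im, Complex.mul_im, mul_zero,
      mul_one, sub_zero, add_zero, zero_add, abs_le] at hre him
    fin_cases i
    · constructor <;> simp <;> linarith
    · constructor <;> simp <;> linarith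
  rw [h1, h2, schwartzCoeff, SchwartzMap.fourier_coe, Real.fourier_eq',
    ← Complex.volume_preserving_equiv_pi.integral_comp']
  refine MeasureTheory.integral_congr_ae (.of_forall fun v ↦ ?_)
  simp only [g, Complex.measurableEquivPi_apply, smul_eq_mul]
  congr 1
  · simp [gaussInt, Complex.inner]
  · simp [Complex.re_add_im]

/-- Fourier expansion of a smooth function supported in a fundamental square of the lattice. -/
theorem synth_schwartzCoeff {u : 𝓢(ℂ, ℂ)} (h : ∀ x, 1 / 4 ≤ ‖x‖ → u x = 0) {x : ℂ}
    (hx : ‖x‖ < 1 / 4) : synth (schwartzCoeff u) x = u x := by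
  let F : C(UnitAddTorus (Fin 2), ℂ) :=
    ⟨fun t ↦ u (torusRep t), continuous_comp_torusRep u.continuous h⟩
  let e : (Fin 2 → ℤ) ≃ ℤ × ℤ := finTwoArrowEquiv ℤ
  have hc : ∀ n, UnitAddTorus.mFourierCoeff F n = schwartzCoeff u (e n) := fun n ↦
    mFourierCoeff_comp_torusRep h n
  have hs : Summable (UnitAddTorus.mFourierCoeff F) := by
    rw [funext hc]
    exact e.summable_iff.2 (.of_norm (rapidDecay_schwartzCoeff u).summable)
  have hre := (Complex.abs_re_le_norm x).trans hx.le
  have him := (Complex.abs_im_le_norm x).trans hx.le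
  rw [abs_le] at hre him
  have hS := UnitAddTorus.hasSum_mFourier_series_apply_of_summable hs
    (fun i ↦ ((![x.re, x.im] i : ℝ) : UnitAddCircle))
  have hFx : F (fun i ↦ ((![x.re, x.im] i : ℝ) : UnitAddCircle)) = u x := by
    have : torusRep (fun i ↦ ((![x.re, x.im] i : ℝ) : UnitAddCircle)) = x := by
      rw [torusRep_coe]
      · simp [Complex.re_add_im]
      · intro i
        fin_cases i
        · constructor <;> simp <;> linarith
        · constructor <;> simp <;> linarith
    change u (torusRep _) = _
    rw [this]
  rw [hFx] at hS
  rw [synth, ← hS.tsum_eq, ← e.tsum_eq]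
  refine tsum_congr fun n ↦ ?_
  rw [hc, smul_eq_mul]
  congr 1
  simp only [UnitAddTorus.mFourier, ContinuousMap.coe_mk, Fin.prod_univ_two, fourier_coe_apply,
        ← Complex.exp_add, latticeChar]
  congr 1
  simp [e, gaussInt, Complex.inner]
  ring

end FourierExpansion

/-! ### Convergent families of Beltrami solutions, and Beltrami coefficients of complex structures.
-/

section BeltramiFamilies

open scoped ENNReal NNReal ComplexConjugate SchwartzMap
open Complex (I)

/-- `e` is a diffeomorphism of the plane fixing the origin and solving the Beltrami equation with
coefficient `u` near the origin. -/
structure IsBeltramiHomeo (u : ℂ → ℂ) (e : ℂ ≃ₜ ℂ) : Prop where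
  map_zero : e 0 = 0
  contDiff : ContDiff ℝ ∞ e
  contDiff_symm : ContDiff ℝ ∞ e.symm
  lipschitz_symm : LipschitzWith 2 e.symm
  fderiv_apply : ∀ x, ‖x‖ < 1 / 4 → ∃ p : ℂ, ∀ v, fderiv ℝ e x v = p * v + u x * p * conj v

theorem exists_isBeltramiHomeo {u : 𝓢(ℂ, ℂ)} (hu : ∀ x, 1 / 4 ≤ ‖x‖ → u x = 0)
    (hs : wnorm (latticeWeight 1 0) (schwartzCoeff u) < 1 / 8) :
    ∃ e : ℂ ≃ₜ ℂ, IsBeltramiHomeo u e ∧ ⇑e = beltramiMap (schwartzCoeff u) := by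
  have ha := rapidDecay_schwartzCoeff u
  obtain ⟨e, h1, h2, h3⟩ := exists_beltramiMap_homeomorph ha hs
  refine ⟨e, ⟨by rw [h1, beltramiMap_zero], h1 ▸ contDiff_beltramiMap ha hs, h2, h3, fun x hx ↦
    ⟨1 + beltramiDz (schwartzCoeff u) x, fun v ↦ ?_⟩⟩, h1⟩
  rw [h1, (hasFDerivAt_beltramiMap ha hs x).fderiv, synth_beltramiCoeff ha hs,
    synth_schwartzCoeff hu hx]
  simp
  ring

theorem exists_isBeltramiHomeo_tendsto {ι : Type*} {l : Filter ι} {u : ι → 𝓢(ℂ, ℂ)} {u₀ : 𝓢(ℂ, ℂ)}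
    (hu : ∀ i x, 1 / 4 ≤ ‖x‖ → u i x = 0) (hu₀ : ∀ x, 1 / 4 ≤ ‖x‖ → u₀ x = 0)
    (hs : ∀ i, wnorm (latticeWeight 1 0) (schwartzCoeff (u i)) < 1 / 8)
    (hs₀ : wnorm (latticeWeight 1 0) (schwartzCoeff u₀) < 1 / 8) (h : Tendsto u l (𝓝 u₀)) :
    ∃ (e : ι → ℂ ≃ₜ ℂ) (e₀ : ℂ ≃ₜ ℂ), (∀ i, IsBeltramiHomeo (u i) (e i)) ∧ IsBeltramiHomeo u₀ e₀ ∧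
      ∀ N y, CTendstoAt N l (fun i ↦ (e i).symm) e₀.symm y := by
  choose e he1 he2 using fun i ↦ exists_isBeltramiHomeo (hu i) (hs i)
  obtain ⟨e₀, h1, h2⟩ := exists_isBeltramiHomeo hu₀ hs₀
  refine ⟨e, e₀, he1, h1, CTendstoAt.symm (fun i ↦ (he1 i).contDiff) h1.contDiff
    (fun i ↦ (he1 i).contDiff_symm) h1.contDiff_symm (fun i ↦ (he1 i).lipschitz_symm) fun N x ↦ ?_⟩
  simp only [he2, h2]
  exact CTendstoAt.beltramiMap (fun i ↦ rapidDecay_schwartzCoeff _) (rapidDecay_schwartzCoeff _) hs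
    hs₀ (tendsto_wnorm_schwartzCoeff_sub h) N x

/-- The complex linear part of a real linear endomorphism of the plane. -/
noncomputable def linPart (T : ℂ →L[ℝ] ℂ) : ℂ := (T 1 - I * T I) / 2

/-- The complex antilinear part of a real linear endomorphism of the plane. -/
noncomputable def antilinPart (T : ℂ →L[ℝ] ℂ) : ℂ := (T 1 + I * T I) / 2

/-- The Beltrami coefficient of a linear complex structure on the plane. -/
noncomputable def beltramiOf (T : ℂ →L[ℝ] ℂ) : ℂ := antilinPart T / (I - conj (linPart T))

theorem apply_eq_linPart_add (T : ℂ →L[ℝ] ℂ) (v : ℂ) :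
    T v = linPart T * v + antilinPart T * conj v := by
  have h : T v = v.re * T 1 + v.im * T I := by
    have e : v = v.re • (1 : ℂ) + v.im • I := by simp [Complex.re_add_im]
    nth_rewrite 1 [e]
    rw [map_add, map_smul, map_smul, Complex.real_smul, Complex.real_smul]
  have h2 : conj v = v.re - v.im * I := by apply Complex.ext <;> simp
  rw [h, h2]
  nth_rewrite 3 [← Complex.re_add_im v]
  rw [linPart, antilinPart]
  linear_combination ((v.im : ℂ) * T I) * Complex.I_mul_I

theorem I_sub_conj_ne_zero {a : ℂ} (h : 0 < a.im) : I - conj a ≠ 0 := fun h0 ↦ by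
  have := congrArg Complex.im h0
  simp at this
  linarith

/-- A map solving the Beltrami equation of a complex structure is holomorphic for it. -/
theorem beltramiOf_spec {T : ℂ →L[ℝ] ℂ} (hT : ∀ v, T (T v) = -v) (h : 0 < (linPart T).im) (p v : ℂ) :
    p * T v + beltramiOf T * p * conj (T v) = I * (p * v + beltramiOf T * p * conj v) := by
  set a := linPart T with ha
  set b := antilinPart T with hb
  -- These are the linear and antilinear parts of `T ∘ T = -1`.
  have h1 : a * a + b * conj b = -1 ∧ a * b + b * conj a = 0 := by
    have e1 := hT 1
    have e2 := hT I
    simp only [apply_eq_linPart_add T, ← ha, ← hb, map_add, map_mul, map_neg, map_one,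
      Complex.conj_I, neg_neg] at e1 e2
    constructor
    · linear_combination (1 / 2) * e1 - I / 2 * e2 +
        ((a * a - a * b - b * conj a + b * conj b + 1) / 2) * Complex.I_mul_I
    · linear_combination (1 / 2) * e1 + I / 2 * e2 -
        ((a * a - a * b - b * conj a + b * conj b + 1) / 2) * Complex.I_mul_I
  obtain ⟨h1, h2⟩ := h1
  -- Either `a + conj a = 0`, or `b = 0` and `a² = -1`, where `Im a > 0` selects `a = I`.
  have h3 : conj a = -a := by
    have h4 : b * (a + conj a) = 0 := by linear_combination h2
    rcases mul_eq_zero.1 h4 with h5 | h5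
    · rw [h5, zero_mul, add_zero] at h1
      have h6 : (a - I) * (a + I) = 0 := by linear_combination h1 - Complex.I_mul_I
      rcases mul_eq_zero.1 h6 with h7 | h7
      · rw [sub_eq_zero.1 h7, Complex.conj_I]
      · rw [eq_neg_of_add_eq_zero_left h7] at h
        simp at h
        linarith
    · linear_combination h5
  have h0 := I_sub_conj_ne_zero h
  -- This and `hμ2` are the coefficients of `conj v` and `v` in the claim, divided by `p`.
  have hμ : beltramiOf T * (I - conj a) = b := div_mul_cancel₀ _ h0
  have hμ2 : a + beltramiOf T * conj b = I := by
    refine mul_right_cancel₀ h0 ?_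
    linear_combination (conj b) * hμ + h1 + (I - a) * h3 - Complex.I_mul_I
  rw [apply_eq_linPart_add T v, ← ha, ← hb]
  simp only [map_add, map_mul, Complex.conj_conj]
  linear_combination (p * v) * hμ2 - p * conj v * hμ

theorem contDiff_linPart {n : WithTop ℕ∞} : ContDiff ℝ n linPart := by
  have h1 : ContDiff ℝ n fun T : ℂ →L[ℝ] ℂ ↦ T 1 := (ContinuousLinearMap.apply ℝ ℂ (1 : ℂ)).contDiff
  have h2 : ContDiff ℝ n fun T : ℂ →L[ℝ] ℂ ↦ T I := (ContinuousLinearMap.apply ℝ ℂ I).contDiff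
  exact (h1.sub (contDiff_const.mul h2)).div_const 2

theorem contDiff_antilinPart {n : WithTop ℕ∞} : ContDiff ℝ n antilinPart := by
  have h1 : ContDiff ℝ n fun T : ℂ →L[ℝ] ℂ ↦ T 1 := (ContinuousLinearMap.apply ℝ ℂ (1 : ℂ)).contDiff
  have h2 : ContDiff ℝ n fun T : ℂ →L[ℝ] ℂ ↦ T I := (ContinuousLinearMap.apply ℝ ℂ I).contDiff
  exact (h1.add (contDiff_const.mul h2)).div_const 2

theorem contDiffAt_beltramiOf {n : WithTop ℕ∞} {T : ℂ →L[ℝ] ℂ} (h : 0 < (linPart T).im) :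
    ContDiffAt ℝ n beltramiOf T := by
  have h1 : ContDiff ℝ n fun T ↦ I - conj (linPart T) :=
    contDiff_const.sub (Complex.conjCLE.contDiff.comp contDiff_linPart)
  have h2 : beltramiOf = fun T ↦ antilinPart T * (I - conj (linPart T))⁻¹ :=
    funext fun T ↦ div_eq_mul_inv _ _
  rw [h2]
  exact contDiff_antilinPart.contDiffAt.mul (h1.contDiffAt.inv (I_sub_conj_ne_zero h))

end BeltramiFamilies

/-! ### Holomorphic disks in the plane by localization and rescaling. -/

section LocalDisks

open scoped ENNReal NNReal ComplexConjugate SchwartzMap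
open Complex (I)

/-- `g` is a diffeomorphism of the plane, fixing the origin, whose restriction to the unit disk is a
`J`-holomorphic map into the disk of radius `r`. -/
structure IsHolomorphicDisk (r : ℝ) (J : ℂ → ℂ →L[ℝ] ℂ) (g : ℂ ≃ₜ ℂ) : Prop where
  map_zero : g 0 = 0
  contDiff : ContDiff ℝ ∞ g
  contDiff_symm : ContDiff ℝ ∞ g.symm
  mapsTo : ∀ w, ‖w‖ < 1 → ‖g w‖ < r
  fderiv_I_mul : ∀ w, ‖w‖ < 1 → ∀ v, fderiv ℝ g w (I * v) = J (g w) (fderiv ℝ g w v)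

/-- The map `w ↦ ε e⁻¹(w / 16)`. -/
noncomputable def scaledSymm (ε : ℝ) (hε : ε ≠ 0) (e : ℂ ≃ₜ ℂ) : ℂ ≃ₜ ℂ :=
  ((Homeomorph.smulOfNeZero (16⁻¹ : ℝ) (by norm_num)).trans e.symm).trans
    (Homeomorph.smulOfNeZero ε hε)

theorem scaledSymm_eq (ε : ℝ) (hε : ε ≠ 0) (e : ℂ ≃ₜ ℂ) :
    ⇑(scaledSymm ε hε e) = (fun z : ℂ ↦ ε • z) ∘ e.symm ∘ fun w : ℂ ↦ (16⁻¹ : ℝ) • w := rfl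

theorem scaledSymm_symm_eq (ε : ℝ) (hε : ε ≠ 0) (e : ℂ ≃ₜ ℂ) :
    ⇑(scaledSymm ε hε e).symm =
      (fun z : ℂ ↦ (16⁻¹ : ℝ)⁻¹ • z) ∘ e ∘ fun w : ℂ ↦ ε⁻¹ • w := rfl

/-- Solving the Beltrami equation means `de ∘ J = i de`, with `J` taken at `εx`, so the inverse of
`e` intertwines `i` and `J`. As `e⁻¹` is 2-Lipschitz, the factor `1/16` sends the unit disk into the
disk of radius `1/8`, where `u` is the true coefficient. -/
theorem IsBeltramiHomeo.isHolomorphicDisk {u : ℂ → ℂ} {e : ℂ ≃ₜ ℂ} (he : IsBeltramiHomeo u e)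
    {ε r : ℝ} (hε : 0 < ε) (hεr : ε ≤ r) {J : ℂ → ℂ →L[ℝ] ℂ}
    (hJ : ∀ x, ‖x‖ < r → ∀ v, J x (J x v) = -v) (hpos : ∀ x, ‖x‖ < r → 0 < (linPart (J x)).im)
    (hu : ∀ x, ‖x‖ < 1 / 8 → u x = beltramiOf (J (ε • x))) :
    IsHolomorphicDisk r J (scaledSymm ε hε.ne' e) := by
  have hs0 : e.symm 0 = 0 := by rw [Homeomorph.symm_apply_eq, he.map_zero]
  have hsmall : ∀ w : ℂ, ‖w‖ < 1 → ‖e.symm ((16⁻¹ : ℝ) • w)‖ < 1 / 8 := fun w hw ↦ by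
    have h1 := he.lipschitz_symm.dist_le_mul ((16⁻¹ : ℝ) • w) 0
    rw [hs0, dist_zero_right, dist_zero_right, norm_smul, Real.norm_of_nonneg (by norm_num),
      NNReal.coe_ofNat] at h1
    linarith
  have hball : ∀ x : ℂ, ‖x‖ < 1 / 8 → ‖ε • x‖ < r := fun x hx ↦ by
    rw [norm_smul, Real.norm_of_nonneg hε.le]
    nlinarith [norm_nonneg x]
  refine ⟨by simp [scaledSymm_eq, hs0], ?_, ?_, fun w hw ↦ hball _ (hsmall w hw), fun w hw v ↦ ?_⟩
  · rw [scaledSymm_eq]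
    exact (contDiff_const_smul _).comp (he.contDiff_symm.comp (contDiff_const_smul _))
  · rw [scaledSymm_symm_eq]
    exact (contDiff_const_smul _).comp (he.contDiff.comp (contDiff_const_smul _))
  · obtain ⟨A, hA, hA'⟩ := e.exists_fderiv_symm he.contDiff he.contDiff_symm ((16⁻¹ : ℝ) • w)
    set x := e.symm ((16⁻¹ : ℝ) • w) with hx
    have hx8 : ‖x‖ < 1 / 8 := hsmall w hw
    have hgw : scaledSymm ε hε.ne' e w = ε • x := rfl
    have hd : ∀ v, fderiv ℝ (scaledSymm ε hε.ne' e) w v = ε • A.symm ((16⁻¹ : ℝ) • v) := fun v ↦ by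
      have d1 : HasFDerivAt (fun w : ℂ ↦ (16⁻¹ : ℝ) • w) ((16⁻¹ : ℝ) • ContinuousLinearMap.id ℝ ℂ) w :=
        (hasFDerivAt_id w).const_smul (16⁻¹ : ℝ)
      have d2 : HasFDerivAt e.symm (A.symm : ℂ →L[ℝ] ℂ) ((16⁻¹ : ℝ) • w) := by
        rw [← hA']
        exact (he.contDiff_symm.differentiable (by simp) _).hasFDerivAt
      have d3 : HasFDerivAt (fun w : ℂ ↦ ε • w) (ε • ContinuousLinearMap.id ℝ ℂ) x :=
        (hasFDerivAt_id x).const_smul ε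
      have d4 := d3.comp w (d2.comp w d1)
      rw [scaledSymm_eq, d4.fderiv]
      rfl
    obtain ⟨p, hp⟩ := he.fderiv_apply x (by linarith)
    have hAJ : ∀ v, A (J (ε • x) v) = I * A v := fun v ↦ by
      have h1 : ∀ v, A v = p * v + beltramiOf (J (ε • x)) * p * conj v := fun v ↦ by
        rw [← hu x hx8, ← hp, hA]
        rfl
      rw [h1, h1, beltramiOf_spec (hJ _ (hball x hx8)) (hpos _ (hball x hx8))]
    rw [hd, hd, hgw, (J (ε • x)).map_smul]
    congr 1
    apply A.injective
    rw [hAJ, A.apply_symm_apply, A.apply_symm_apply, mul_smul_comm]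

/-- The cutoff function used to localize Beltrami coefficients. -/
noncomputable def diskBump : ContDiffBump (0 : ℂ) where
  rIn := 1 / 8
  rOut := 1 / 5
  rIn_pos := by norm_num
  rIn_lt_rOut := by norm_num

/-- The localized coefficient `x ↦ χ(x) m(ε x)`. -/
noncomputable def cutCoeff (ε : ℝ) (m : ℂ → ℂ) (x : ℂ) : ℂ := diskBump x * m (ε • x)

theorem cutCoeff_of_notMem (ε : ℝ) (m : ℂ → ℂ) {x : ℂ} (hx : x ∉ Metric.closedBall (0 : ℂ) (1 / 5)) :
    cutCoeff ε m x = 0 := by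
  rw [cutCoeff, diskBump.zero_of_le_dist, Complex.ofReal_zero, zero_mul]
  rw [Metric.mem_closedBall, not_le] at hx
  exact hx.le

theorem cutCoeff_of_norm_lt (ε : ℝ) (m : ℂ → ℂ) {x : ℂ} (hx : ‖x‖ < 1 / 8) :
    cutCoeff ε m x = m (ε • x) := by
  rw [cutCoeff, diskBump.one_of_mem_closedBall, Complex.ofReal_one, one_mul]
  simpa [diskBump] using hx.le

theorem norm_smul_lt_of_mem {ε r : ℝ} (hε : 0 < ε) (hεr : ε ≤ r) {x : ℂ}
    (hx : x ∈ Metric.closedBall (0 : ℂ) (1 / 5)) : ‖ε • x‖ < r := by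
  rw [mem_closedBall_zero_iff] at hx
  rw [norm_smul, Real.norm_of_nonneg hε.le]
  nlinarith [norm_nonneg x]

theorem contDiff_diskBump {n : ℕ∞} : ContDiff ℝ n fun x : ℂ ↦ ((diskBump x : ℝ) : ℂ) :=
  Complex.ofRealCLM.contDiff.comp diskBump.contDiff

theorem exists_schwartzMap_cutCoeff {ε r : ℝ} (hε : 0 < ε) (hεr : ε ≤ r) {m : ℂ → ℂ}
    (hm : ∀ x, ‖x‖ < r → ContDiffAt ℝ ∞ m x) : ∃ u : 𝓢(ℂ, ℂ), ⇑u = cutCoeff ε m := by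
  have h1 : HasCompactSupport (cutCoeff ε m) :=
    HasCompactSupport.intro (isCompact_closedBall (0 : ℂ) (1 / 5)) fun x hx ↦
      cutCoeff_of_notMem ε m hx
  have h2 : ContDiff ℝ ∞ (cutCoeff ε m) := by
    rw [contDiff_iff_contDiffAt]
    intro x
    by_cases hx : x ∈ Metric.closedBall (0 : ℂ) (1 / 5)
    · exact contDiff_diskBump.contDiffAt.mul
        ((hm _ (norm_smul_lt_of_mem hε hεr hx)).comp x (contDiff_const_smul ε).contDiffAt)
    · refine (contDiffAt_const (c := (0 : ℂ))).congr_of_eventuallyEq ?_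
      filter_upwards [Metric.isClosed_closedBall.isOpen_compl.mem_nhds hx] with y hy
      exact cutCoeff_of_notMem ε m hy
  exact ⟨h1.toSchwartzMap h2, rfl⟩

theorem CTendstoAt.cutCoeff {ι : Type*} {l : Filter ι} {N : ℕ} {ε : ι → ℝ} {ε₀ : ℝ} {m : ι → ℂ → ℂ}
    {m₀ : ℂ → ℂ} {x : ℂ} (hε : Tendsto ε l (𝓝 ε₀)) (hm : CTendstoAt N l m m₀ (ε₀ • x)) :
    CTendstoAt N l (fun i ↦ cutCoeff (ε i) (m i)) (_root_.cutCoeff ε₀ m₀) x := by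
  have h1 : CTendstoAt N l (fun i (y : ℂ) ↦ ε i • y) (fun y ↦ ε₀ • y) x := by
    have h2 := (CTendstoAt.of_tendsto (N := N) (x := x) hε).prodMk
      (.const (l := l) (contDiff_id (𝕜 := ℝ) (E := ℂ)).contDiffAt)
    exact h2.comp_left (g := fun p : ℝ × ℂ ↦ p.1 • p.2) contDiff_smul.contDiffAt
  have h3 := CTendstoAt.comp (g := m) (g₀ := m₀) hm h1
  have h4 := (CTendstoAt.const (l := l) (N := N)
    (contDiff_diskBump (n := (N : ℕ∞))).contDiffAt).prodMk h3
  exact h4.comp_left (g := fun p : ℂ × ℂ ↦ p.1 * p.2) contDiff_mul.contDiffAt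

/-- Zooming in at the origin makes `m(ε x)` tend smoothly to the constant `m 0 = 0`, so the
localized coefficients tend to `0` in the Schwartz space. -/
theorem exists_small_cutCoeff {r : ℝ} (hr : 0 < r) {m : ℂ → ℂ}
    (hm : ∀ x, ‖x‖ < r → ContDiffAt ℝ ∞ m x) (h0 : m 0 = 0) {δ : ℝ≥0∞} (hδ : 0 < δ) :
    ∃ ε, 0 < ε ∧ ε ≤ r ∧ ∃ u : 𝓢(ℂ, ℂ), ⇑u = cutCoeff ε m ∧
      wnorm (latticeWeight 1 0) (schwartzCoeff u) < δ := by
  let ε : ℕ → ℝ := fun n ↦ r / (n + 1)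
  have hpos : ∀ n, 0 < ε n := fun n ↦ by positivity
  have hle : ∀ n, ε n ≤ r := fun n ↦ div_le_self hr.le (by simp)
  have hlim : Tendsto ε atTop (𝓝 0) := by
    have := (tendsto_one_div_add_atTop_nhds_zero_nat (𝕜 := ℝ)).const_mul r
    simpa [ε, div_eq_mul_inv] using this
  choose u hu using fun n ↦ exists_schwartzMap_cutCoeff (hpos n) (hle n) hm
  have h1 : Tendsto u atTop (𝓝 0) := by
    refine tendsto_schwartzMap_of_cTendstoAt (isCompact_closedBall (0 : ℂ) (1 / 5))
      (fun n x hx ↦ by rw [hu]; exact cutCoeff_of_notMem _ _ hx) (fun _ _ ↦ rfl) fun N x _ ↦ ?_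
    have h2 : CTendstoAt N atTop (fun _ : ℕ ↦ m) m ((0 : ℝ) • x) := by
      refine .const ((hm _ ?_).of_le (mod_cast le_top))
      simpa using hr
    have h3 := CTendstoAt.cutCoeff hlim h2
    simp only [hu]
    refine h3.congr (.of_forall fun _ ↦ EventuallyEq.rfl) (.of_forall fun y ↦ ?_)
    simp [cutCoeff, h0]
  have h4 := tendsto_wnorm_schwartzCoeff_sub h1 0
  have h5 : schwartzCoeff 0 = 0 := by
    ext k
    have : FourierTransform.fourier (0 : 𝓢(ℂ, ℂ)) = (0 : 𝓢(ℂ, ℂ)) :=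
      map_zero (FourierTransform.fourierCLM ℂ 𝓢(ℂ, ℂ))
    simp [schwartzCoeff, this]
  simp only [h5, Pi.zero_apply, sub_zero] at h4
  obtain ⟨n, hn⟩ := (h4.eventually_lt_const hδ).exists
  exact ⟨ε n, hpos n, hle n, u n, hu n, hn⟩

theorem beltramiOf_eq_zero {T : ℂ →L[ℝ] ℂ} (h : ∀ v, T v = I * v) : beltramiOf T = 0 := by
  simp [beltramiOf, antilinPart, h]

theorem linPart_eq_I {T : ℂ →L[ℝ] ℂ} (h : ∀ v, T v = I * v) : linPart T = I := by
  simp only [linPart, h]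
  linear_combination (-I / 2) * Complex.I_mul_I

/-- Local existence of holomorphic disks, depending smoothly on the complex structure. -/
theorem exists_isHolomorphicDisk_tendsto {ι : Type*} {l : Filter ι} {J : ι → ℂ → ℂ →L[ℝ] ℂ}
    {J₀ : ℂ → ℂ →L[ℝ] ℂ} {R : ℝ} (hR : 0 < R) (hJ : ∀ i x, ‖x‖ < R → ContDiffAt ℝ ∞ (J i) x)
    (hJ₀ : ∀ x, ‖x‖ < R → ContDiffAt ℝ ∞ J₀ x) (hJJ : ∀ i x, ‖x‖ < R → ∀ v, J i x (J i x v) = -v)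
    (hJJ₀ : ∀ x, ‖x‖ < R → ∀ v, J₀ x (J₀ x v) = -v)
    (hlim : ∀ (N : ℕ) x, ‖x‖ < R → CTendstoAt N l J J₀ x) (h0 : ∀ v, J₀ 0 v = I * v) :
    ∃ (g : ι → ℂ ≃ₜ ℂ) (g₀ : ℂ ≃ₜ ℂ), (∀ᶠ i in l, IsHolomorphicDisk R (J i) (g i)) ∧
      IsHolomorphicDisk R J₀ g₀ ∧ ∀ N w, CTendstoAt N l (fun i ↦ g i) g₀ w := by
  classical
  have hcl : Continuous linPart := (contDiff_linPart (n := 0)).continuous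
  obtain ⟨r, hr, hrR, hpos₀⟩ : ∃ r, 0 < r ∧ r < R ∧ ∀ x, ‖x‖ ≤ r → 0 < (linPart (J₀ x)).im := by
    have hc : ContinuousAt (fun x ↦ (linPart (J₀ x)).im) 0 :=
      (Complex.continuous_im.comp hcl).continuousAt.comp (hJ₀ 0 (by simpa)).continuousAt
    have h1 : ∀ᶠ x in 𝓝 (0 : ℂ), 0 < (linPart (J₀ x)).im :=
      hc.eventually_const_lt (by simp [linPart_eq_I h0])
    obtain ⟨ρ, hρ, h2⟩ := Metric.eventually_nhds_iff.1 h1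
    refine ⟨min (ρ / 2) (R / 2), by positivity, (min_le_right _ _).trans_lt (by linarith),
      fun x hx ↦ h2 ?_⟩
    rw [dist_zero_right]
    exact (hx.trans (min_le_left _ _)).trans_lt (by linarith)
  have hpos : ∀ᶠ i in l, ∀ x ∈ Metric.closedBall (0 : ℂ) r, 0 < (linPart (J i x)).im := by
    refine (isCompact_closedBall (0 : ℂ) r).eventually_forall_of_prod fun x hx ↦ ?_
    have hx' : ‖x‖ ≤ r := by simpa using hx
    have h1 := (hlim 0 x (hx'.trans_lt hrR)).tendsto_zero
    have h2 := ((Complex.continuous_im.comp hcl).tendsto _).comp h1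
    exact h2.eventually_const_lt (hpos₀ x hx')
  have hm : ∀ {T : ℂ → ℂ →L[ℝ] ℂ}, (∀ x, ‖x‖ < R → ContDiffAt ℝ ∞ T x) →
      (∀ x, ‖x‖ ≤ r → 0 < (linPart (T x)).im) →
      ∀ x, ‖x‖ < r → ContDiffAt ℝ ∞ (beltramiOf ∘ T) x := fun hT hT' x hx ↦
    (contDiffAt_beltramiOf (hT' x hx.le)).comp x (hT x (hx.trans hrR))
  -- The bound `1/16` is half of the admissible `1/8`, leaving room for the perturbation from `J₀`
  -- to `J i`; one `ε` serves all indices.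
  obtain ⟨ε, hε, hεr, u₀, hu₀, hsu₀⟩ := exists_small_cutCoeff hr (hm hJ₀ hpos₀)
    (beltramiOf_eq_zero h0) (δ := 1 / 16) (by simp)
  have hex : ∀ i, ∃ u : 𝓢(ℂ, ℂ), (∀ x ∈ Metric.closedBall (0 : ℂ) r, 0 < (linPart (J i x)).im) →
      ⇑u = cutCoeff ε (beltramiOf ∘ J i) := fun i ↦ by
    by_cases h : ∀ x ∈ Metric.closedBall (0 : ℂ) r, 0 < (linPart (J i x)).im
    · obtain ⟨u, hu⟩ := exists_schwartzMap_cutCoeff hε hεr (hm (hJ i) fun x hx ↦ h x (by simpa))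
      exact ⟨u, fun _ ↦ hu⟩
    · exact ⟨0, fun h' ↦ absurd h' h⟩
  choose u hu using hex
  let good : ι → Prop := fun i ↦ (∀ x ∈ Metric.closedBall (0 : ℂ) r, 0 < (linPart (J i x)).im) ∧
    wnorm (latticeWeight 1 0) (schwartzCoeff (u i)) < 1 / 8
  -- Bad indices receive `u₀`, so that every member is admissible. The variant `u''` tests
  -- positivity only: its convergence is proved first and shows that eventually all indices are
  -- good.
  let u' : ι → 𝓢(ℂ, ℂ) := fun i ↦ if good i then u i else u₀
  let u'' : ι → 𝓢(ℂ, ℂ) := fun i ↦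
    if ∀ x ∈ Metric.closedBall (0 : ℂ) r, 0 < (linPart (J i x)).im then u i else u₀
  have hsu₀' : wnorm (latticeWeight 1 0) (schwartzCoeff u₀) < 1 / 8 :=
    hsu₀.trans_le (ENNReal.div_le_div_left (by norm_num) 1)
  have hlim'' : Tendsto u'' l (𝓝 u₀) := by
    refine tendsto_schwartzMap_of_cTendstoAt (isCompact_closedBall (0 : ℂ) (1 / 5)) (fun i x hx ↦ ?_)
      (fun x hx ↦ by rw [hu₀]; exact cutCoeff_of_notMem _ _ hx) fun N x hx ↦ ?_
    · simp only [u'']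
      split_ifs with h
      · rw [hu i h]
        exact cutCoeff_of_notMem _ _ hx
      · rw [hu₀]
        exact cutCoeff_of_notMem _ _ hx
    · have hx' := norm_smul_lt_of_mem hε hεr hx
      have h1 : CTendstoAt N l (fun i ↦ beltramiOf ∘ J i) (beltramiOf ∘ J₀) (ε • x) :=
        (hlim N _ (hx'.trans hrR)).comp_left (contDiffAt_beltramiOf (hpos₀ _ hx'.le))
      rw [hu₀]
      refine (CTendstoAt.cutCoeff (tendsto_const_nhds (x := ε)) h1).congr ?_ EventuallyEq.rfl
      filter_upwards [hpos.prod_inl (𝓝 x)] with p hp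
      simp only [u'', if_pos hp, hu p.1 hp]
      rfl
  have hsmall : ∀ᶠ i in l, good i := by
    have h1 := (tendsto_wnorm_schwartzCoeff_sub hlim'' 0).eventually_lt_const
      (u := 1 / 16) (by simp)
    filter_upwards [h1, hpos] with i h2 h3
    refine ⟨h3, ?_⟩
    simp only [u'', if_pos h3] at h2
    have e : schwartzCoeff (u i) = fun k ↦ (schwartzCoeff (u i) k - schwartzCoeff u₀ k) +
        schwartzCoeff u₀ k := by ext; ring
    rw [e]
    refine ((wnorm_add_le _ _ _).trans_lt (ENNReal.add_lt_add h2 hsu₀)).trans_le ?_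
    rw [ENNReal.div_add_div_same, ENNReal.le_div_iff_mul_le (by simp) (by simp)]
    rw [ENNReal.div_eq_inv_mul, mul_assoc]
    norm_num
  have hgood : ∀ i, good i → u' i = u i := fun i hi ↦ if_pos hi
  have hvan : ∀ i x, x ∉ Metric.closedBall (0 : ℂ) (1 / 5) → u' i x = 0 := fun i x hx ↦ by
    simp only [u']
    split_ifs with h
    · rw [hu i h.1]
      exact cutCoeff_of_notMem _ _ hx
    · rw [hu₀]
      exact cutCoeff_of_notMem _ _ hx
  have hout : ∀ x : ℂ, 1 / 4 ≤ ‖x‖ → x ∉ Metric.closedBall (0 : ℂ) (1 / 5) := fun x hx h ↦ by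
    rw [mem_closedBall_zero_iff] at h
    linarith
  have hlim' : Tendsto u' l (𝓝 u₀) := by
    refine hlim''.congr' ?_
    filter_upwards [hsmall] with i hi
    rw [hgood i hi]
    exact if_pos hi.1
  obtain ⟨e, e₀, he, he₀, hconv⟩ := exists_isBeltramiHomeo_tendsto (l := l) (u := u') (u₀ := u₀)
    (fun i x hx ↦ hvan i x (hout x hx))
    (fun x hx ↦ by rw [hu₀]; exact cutCoeff_of_notMem _ _ (hout x hx)) (fun i ↦ by
      simp only [u']
      split_ifs with h
      exacts [h.2, hsu₀']) hsu₀' hlim'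
  have hup : ∀ {T : ℂ → ℂ →L[ℝ] ℂ} {g : ℂ ≃ₜ ℂ}, IsHolomorphicDisk r T g → IsHolomorphicDisk R T g :=
    fun h ↦ ⟨h.1, h.2, h.3, fun w hw ↦ (h.4 w hw).trans hrR, h.5⟩
  refine ⟨fun i ↦ scaledSymm ε hε.ne' (e i), scaledSymm ε hε.ne' e₀, ?_, hup ?_, fun N w ↦ ?_⟩
  · filter_upwards [hsmall] with i hi
    refine hup ((he i).isHolomorphicDisk hε hεr (fun x hx ↦ hJJ i x (hx.trans hrR))
      (fun x hx ↦ hi.1 x (by simpa using hx.le)) fun x hx ↦ ?_)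
    rw [hgood i hi, hu i hi.1]
    exact cutCoeff_of_norm_lt _ _ hx
  · refine he₀.isHolomorphicDisk hε hεr (fun x hx ↦ hJJ₀ x (hx.trans hrR))
      (fun x hx ↦ hpos₀ x hx.le) fun x hx ↦ ?_
    rw [hu₀]
    exact cutCoeff_of_norm_lt _ _ hx
  · simp only [scaledSymm_eq]
    refine CTendstoAt.comp_left (contDiff_const_smul ε).contDiffAt (CTendstoAt.comp ?_
      (.const (contDiff_const_smul _).contDiffAt))
    exact hconv N _

end LocalDisks

/-! ### Transfer between the surface and its charts. -/

section InChart

variable {S : Type*} [TopologicalSpace S] [ChartedSpace (EuclideanHalfSpace 2) S]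
  [IsManifold (𝓡∂ 2) ∞ S]

namespace SurfaceComplexStructure

variable (j : SurfaceComplexStructure S) {x₀ : S} {y : Plane}

theorem inChart_eq_comp (hy : y ∈ (extChartAt (𝓡∂ 2) x₀).target) :
    j.inChart x₀ y =
      (mfderiv (𝓡∂ 2) 𝓘(ℝ, Plane) (extChartAt (𝓡∂ 2) x₀)
          ((extChartAt (𝓡∂ 2) x₀).symm y)) ∘L
        j.toFun ((extChartAt (𝓡∂ 2) x₀).symm y) ∘L
          (mfderivWithin 𝓘(ℝ, Plane) (𝓡∂ 2) (extChartAt (𝓡∂ 2) x₀).symm (range (𝓡∂ 2)) y) := by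
  have hs : (extChartAt (𝓡∂ 2) x₀).symm y ∈ (chartAt (EuclideanHalfSpace 2) x₀).source := by
    simpa using (extChartAt (𝓡∂ 2) x₀).map_target hy
  have := inTangentCoordinates_eq_mfderiv_comp (I := 𝓡∂ 2) (I' := 𝓡∂ 2) (f := id) (g := id)
    (ϕ := j.toFun) (x₀ := x₀) (x := (extChartAt (𝓡∂ 2) x₀).symm y) hs hs
  -- The general formula evaluates this derivative at `φ (φ⁻¹ y)`; its type depends on the point, so
  -- the replacement by `y` is made separately.
  have hr : ∀ y', y' = y → (mfderivWithin 𝓘(ℝ, Plane) (𝓡∂ 2) (extChartAt (𝓡∂ 2) x₀).symm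
      (range (𝓡∂ 2)) y' : Plane →L[ℝ] Plane) =
      mfderivWithin 𝓘(ℝ, Plane) (𝓡∂ 2) (extChartAt (𝓡∂ 2) x₀).symm (range (𝓡∂ 2)) y := by
    rintro _ rfl
    rfl
  exact this.trans (congrArg (fun L : Plane →L[ℝ] Plane ↦
    (mfderiv (𝓡∂ 2) 𝓘(ℝ, Plane) (extChartAt (𝓡∂ 2) x₀)
      ((extChartAt (𝓡∂ 2) x₀).symm y) : Plane →L[ℝ] Plane) ∘L
        (j.toFun ((extChartAt (𝓡∂ 2) x₀).symm y) : Plane →L[ℝ] Plane) ∘L L)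
      (hr _ ((extChartAt (𝓡∂ 2) x₀).right_inv hy)))

theorem mfderivWithin_symm_inChart (hy : y ∈ (extChartAt (𝓡∂ 2) x₀).target) (v : Plane) :
    mfderivWithin 𝓘(ℝ, Plane) (𝓡∂ 2) (extChartAt (𝓡∂ 2) x₀).symm (range (𝓡∂ 2)) y
        (j.inChart x₀ y v) =
      j.toFun ((extChartAt (𝓡∂ 2) x₀).symm y)
        (mfderivWithin 𝓘(ℝ, Plane) (𝓡∂ 2) (extChartAt (𝓡∂ 2) x₀).symm (range (𝓡∂ 2)) y v) := by
  rw [j.inChart_eq_comp hy]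
  exact DFunLike.congr_fun (mfderivWithin_extChartAt_symm_comp_mfderiv_extChartAt hy) _

theorem inChart_inChart (hy : y ∈ (extChartAt (𝓡∂ 2) x₀).target) (v : Plane) :
    j.inChart x₀ y (j.inChart x₀ y v) = -v := by
  have h := j.mfderivWithin_symm_inChart hy
  refine (isInvertible_mfderivWithin_extChartAt_symm hy).injective ?_
  have h1 := h (j.inChart x₀ y v)
  rw [h v, j.apply_apply] at h1
  exact h1.trans (map_neg _ v).symm

theorem contDiffAt_inChart (hy : y ∈ interior (extChartAt (𝓡∂ 2) x₀).target) :
    ContDiffAt ℝ ∞ (j.inChart x₀) y := by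
  have hy' := interior_subset hy
  have hs := (extChartAt (𝓡∂ 2) x₀).map_target hy'
  have hs' : (extChartAt (𝓡∂ 2) x₀).symm y ∈ (chartAt (EuclideanHalfSpace 2) x₀).source := by
    simpa using hs
  rw [← contMDiffAt_iff_contDiffAt]
  have h1 : ContMDiffAt (𝓡∂ 2) 𝓘(ℝ, Plane →L[ℝ] Plane) ∞
      (inTangentCoordinates (𝓡∂ 2) (𝓡∂ 2) id id j.toFun x₀)
      ((extChartAt (𝓡∂ 2) x₀).symm y) := by
    have h := j.smooth.contMDiffAt (x := (extChartAt (𝓡∂ 2) x₀).symm y)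
    have h2 := (Bundle.Trivialization.contMDiffAt_section_iff (IB := 𝓡∂ 2) (n := ∞)
      (s := j.toFun) (trivializationAt (Plane →L[ℝ] Plane) (fun x : S ↦
        (TangentSpace (𝓡∂ 2) x →L[ℝ] TangentSpace (𝓡∂ 2) x)) x₀)
      (x₀ := (extChartAt (𝓡∂ 2) x₀).symm y) (by simpa using hs')).1 h
    exact h2
  have h2 : ContMDiffAt 𝓘(ℝ, Plane) (𝓡∂ 2) ∞ (extChartAt (𝓡∂ 2) x₀).symm y :=
    (contMDiffOn_extChartAt_symm x₀).contMDiffAt (mem_interior_iff_mem_nhds.1 hy)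
  exact h1.comp y h2

end SurfaceComplexStructure

/-- At interior points of the chart image the derivatives within it are ordinary derivatives, and a
small closed ball serves as the compact set. -/
theorem TendstoSmooth.cTendstoAt {jn : ℕ → SurfaceComplexStructure S}
    {j : SurfaceComplexStructure S} (hj : TendstoSmooth jn j) (x₀ : S) {y : Plane}
    (hy : y ∈ interior (extChartAt (𝓡∂ 2) x₀).target) (N : ℕ) :
    CTendstoAt N atTop (fun n ↦ (jn n).inChart x₀) (j.inChart x₀) y := by
  have hle : ((N : ℕ∞) : WithTop ℕ∞) ≤ ∞ := by exact_mod_cast le_top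
  have hop : IsOpen (interior (extChartAt (𝓡∂ 2) x₀).target) := isOpen_interior
  obtain ⟨ρ, hρ, hsub⟩ := Metric.nhds_basis_closedBall.mem_iff.1 (hop.mem_nhds hy)
  have heq : ∀ (f : Plane → Plane →L[ℝ] Plane) (m : ℕ),
      ∀ x ∈ interior (extChartAt (𝓡∂ 2) x₀).target,
      iteratedFDerivWithin ℝ m f (extChartAt (𝓡∂ 2) x₀).target x = iteratedFDeriv ℝ m f x := by
    intro f m x hx
    rw [← iteratedFDerivWithin_univ]
    exact iteratedFDerivWithin_congr_set
      (eventuallyEq_univ.mpr (mem_interior_iff_mem_nhds.1 hx)) m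
  refine ⟨?_, (j.contDiffAt_inChart hy).of_le hle, fun m hm ↦ ?_⟩
  · filter_upwards [tendsto_snd.eventually (hop.mem_nhds hy)] with q hq
    exact ((jn q.1).contDiffAt_inChart hq).of_le hle
  · have h := (hj x₀ _ (isCompact_closedBall y ρ) (hsub.trans interior_subset) m).congr
      (F' := fun n ↦ iteratedFDeriv ℝ m ((jn n).inChart x₀))
      (.of_forall fun n x hx ↦ heq _ m x (hsub hx))
    have h := h.congr_right (g := iteratedFDeriv ℝ m (j.inChart x₀))
      (fun x hx ↦ heq _ m x (hsub hx))
    exact h.tendsto_prod (Metric.closedBall_mem_nhds y hρ)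
      (((j.contDiffAt_inChart hy).of_le hle).continuousAt_iteratedFDeriv (mod_cast hm))


theorem tendstoSmooth_const (j : SurfaceComplexStructure S) : TendstoSmooth (fun _ ↦ j) j :=
  fun _ _ _ _ _ _ hu ↦ .of_forall fun _ _ _ ↦ refl_mem_uniformity hu

/-- The parametrization `w ↦ φ⁻¹ (h w)` of a neighbourhood in a surface by the unit disk, where
`φ` is the chart at `x₀` and `h` maps the disk into the interior of the image of `φ`. -/
noncomputable def chartDisk (x₀ : S) (h : ℂ ≃ₜ Plane)
    (hh : MapsTo h (Metric.ball 0 1) (interior (extChartAt (𝓡∂ 2) x₀).target)) :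
    OpenPartialHomeomorph ℂ S where
  toFun w := (extChartAt (𝓡∂ 2) x₀).symm (h w)
  invFun x := h.symm (extChartAt (𝓡∂ 2) x₀ x)
  source := Metric.ball 0 1
  target := (extChartAt (𝓡∂ 2) x₀).source ∩
    extChartAt (𝓡∂ 2) x₀ ⁻¹' (h.symm ⁻¹' Metric.ball 0 1)
  map_source' w hw := by
    have := interior_subset (hh hw)
    refine ⟨(extChartAt (𝓡∂ 2) x₀).map_target this, ?_⟩
    simpa only [mem_preimage, (extChartAt (𝓡∂ 2) x₀).right_inv this, h.symm_apply_apply] using hw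
  map_target' x hx := hx.2
  left_inv' w hw := by
    rw [(extChartAt (𝓡∂ 2) x₀).right_inv (interior_subset (hh hw)), h.symm_apply_apply]
  right_inv' x hx := by
    rw [h.apply_symm_apply, (extChartAt (𝓡∂ 2) x₀).left_inv hx.1]
  open_source := Metric.isOpen_ball
  open_target := (continuousOn_extChartAt x₀).isOpen_inter_preimage (isOpen_extChartAt_source x₀)
    (Metric.isOpen_ball.preimage h.symm.continuous)
  continuousOn_toFun := (continuousOn_extChartAt_symm x₀).comp h.continuous.continuousOn
    fun _ hw ↦ interior_subset (hh hw)
  continuousOn_invFun := h.symm.continuous.comp_continuousOn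
    ((continuousOn_extChartAt x₀).mono inter_subset_left)

theorem isDiskBiholomorphism_chartDisk (j : SurfaceComplexStructure S) {x₀ : S} {h : ℂ ≃ₜ Plane}
    (hh : MapsTo h (Metric.ball 0 1) (interior (extChartAt (𝓡∂ 2) x₀).target))
    (hc : ContDiff ℝ ∞ h) (hcs : ContDiff ℝ ∞ h.symm)
    (hI : ∀ w ∈ Metric.ball (0 : ℂ) 1, ∀ v,
      fderiv ℝ h w (Complex.I * v) = j.inChart x₀ (h w) (fderiv ℝ h w v)) :
    IsDiskBiholomorphism j (chartDisk x₀ h hh) where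
  source_eq := rfl
  contMDiffOn := (contMDiffOn_extChartAt_symm x₀).comp hc.contMDiff.contMDiffOn
    fun _ hw ↦ (hh.mono_right interior_subset) hw
  contMDiffOn_symm := hcs.contMDiff.comp_contMDiffOn
    ((contMDiffOn_extChartAt (n := ∞) (x := x₀)).mono fun x hx ↦ by simpa using hx.1)
  map_I_mul w hw v := by
    have hy := interior_subset (hh hw)
    have hd : HasMFDerivAt 𝓘(ℝ, ℂ) 𝓘(ℝ, Plane) h w (fderiv ℝ h w) :=
      ((hc.differentiable (by simp)) w).hasFDerivAt.hasMFDerivAt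
    have hw' : MDifferentiableWithinAt 𝓘(ℝ, Plane) (𝓡∂ 2) (extChartAt (𝓡∂ 2) x₀).symm
      (range (𝓡∂ 2)) (h w) := mdifferentiableWithinAt_extChartAt_symm hy
    -- Away from the boundary, the derivative within the half-plane is the full derivative.
    have hr : range (𝓡∂ 2) ∈ 𝓝 (h w) :=
      mem_of_superset (mem_interior_iff_mem_nhds.1 (hh hw)) (extChartAt_target_subset_range x₀)
    have hs := hw'.hasMFDerivWithinAt.hasMFDerivAt hr
    have hcomp : mfderiv 𝓘(ℝ, ℂ) (𝓡∂ 2) (chartDisk x₀ h hh) w = _ := (hs.comp w hd).mfderiv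
    rw [hcomp]
    have := j.mfderivWithin_symm_inChart hy (fderiv ℝ h w v)
    rw [← hI w hw v] at this
    exact this

/-- Convergence seen in one chart passes to every other chart by composition with the smooth
transition map; compactness of `K` makes it uniform. -/
theorem tendstoSmoothLoc_of_cTendstoAt {Fn : ℕ → ℂ → S} {F : ℂ → S} {Ω : Set ℂ} (hΩ : IsOpen Ω)
    (x₀ : S) {hn : ℕ → ℂ → Plane} {h : ℂ → Plane}
    (hh : MapsTo h Ω (interior (extChartAt (𝓡∂ 2) x₀).target))
    (hlim : ∀ (N : ℕ), ∀ w ∈ Ω, CTendstoAt N atTop hn h w)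
    (hFn : ∀ᶠ n in atTop, EqOn (Fn n) ((extChartAt (𝓡∂ 2) x₀).symm ∘ hn n) Ω)
    (hF : EqOn F ((extChartAt (𝓡∂ 2) x₀).symm ∘ h) Ω) : TendstoSmoothLoc Fn F Ω := by
  intro x₁ K hK hKΩ hmaps
  set φ := extChartAt (𝓡∂ 2) x₀ with hφ
  set χ := extChartAt (𝓡∂ 2) x₁ with hχ
  set V := interior φ.target ∩ φ.symm ⁻¹' χ.source with hV
  have hVo : IsOpen V := ((continuousOn_extChartAt_symm x₀).mono interior_subset)
    |>.isOpen_inter_preimage isOpen_interior (isOpen_extChartAt_source x₁)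
  have hT : ∀ y ∈ V, ContDiffAt ℝ ∞ (χ ∘ φ.symm) y := by
    intro y hy
    rw [← contMDiffAt_iff_contDiffAt]
    have h2 : ContMDiffAt 𝓘(ℝ, Plane) (𝓡∂ 2) ∞ φ.symm y :=
      (contMDiffOn_extChartAt_symm x₀).contMDiffAt (mem_interior_iff_mem_nhds.1 hy.1)
    exact (contMDiffAt_extChartAt' (by simpa [hχ] using hy.2)).comp y h2
  have hhV : ∀ w ∈ K, h w ∈ V := fun w hw ↦ ⟨hh (hKΩ hw), by
    have := hmaps hw
    rwa [hF (hKΩ hw)] at this⟩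
  have hev : ∀ w ∈ K, ∀ᶠ q in atTop ×ˢ 𝓝 w, hn q.1 q.2 ∈ V := fun w hw ↦
    (hlim 0 w (hKΩ hw)).tendsto_zero.eventually (hVo.mem_nhds (hhV w hw))
  have hC : ∀ (N : ℕ), ∀ w ∈ K, CTendstoAt N atTop (fun n ↦ χ ∘ Fn n) (χ ∘ F) w := by
    intro N w hw
    have hle : ((N : ℕ∞) : WithTop ℕ∞) ≤ ∞ := by exact_mod_cast le_top
    refine (CTendstoAt.comp_left ((hT _ (hhV w hw)).of_le hle) (hlim N w (hKΩ hw))).congr ?_ ?_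
    · filter_upwards [tendsto_fst.eventually hFn,
        tendsto_snd.eventually (hΩ.mem_nhds (hKΩ hw))] with q hq hqw
      filter_upwards [hΩ.mem_nhds hqw] with x hx
      exact (congrArg χ (hq hx)).symm
    · filter_upwards [hΩ.mem_nhds (hKΩ hw)] with x hx
      exact (congrArg χ (hF hx)).symm
  refine ⟨?_, fun m ↦ ?_⟩
  · filter_upwards [hFn, hK.eventually_forall_of_prod (P := fun n x ↦ hn n x ∈ V) hev]
      with n hn1 hn2 w hw
    rw [hn1 (hKΩ hw)]
    exact (hn2 w hw).2
  · have hu := hK.tendstoUniformlyOn_of_prod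
      (A := fun n ↦ iteratedFDeriv ℝ m (χ ∘ Fn n)) (a := iteratedFDeriv ℝ m (χ ∘ F))
      (fun w hw ↦ (hC m w hw).tendsto m le_rfl)
      (fun w hw ↦ (hC m w hw).contDiffAt.continuousAt_iteratedFDeriv le_rfl)
    exact (hu.congr (.of_forall fun n w hw ↦
      (iteratedFDerivWithin_of_isOpen m hΩ (hKΩ hw)).symm)).congr_right
        fun w hw ↦ (iteratedFDerivWithin_of_isOpen m hΩ (hKΩ hw)).symm


/-- A parametrization `h` of a neighbourhood of `φ z`, where `φ` is the chart at `z`, by the unit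
disk, which is holomorphic for the coordinate representation of `j` in `φ`. -/
structure IsChartDisk (j : SurfaceComplexStructure S) (z : S) (h : ℂ ≃ₜ Plane) : Prop where
  map_zero : h 0 = extChartAt (𝓡∂ 2) z z
  mapsTo : MapsTo h (Metric.ball 0 1) (interior (extChartAt (𝓡∂ 2) z).target)
  contDiff : ContDiff ℝ ∞ h
  contDiff_symm : ContDiff ℝ ∞ h.symm
  fderiv_I_mul : ∀ w ∈ Metric.ball (0 : ℂ) 1, ∀ v,
    fderiv ℝ h w (Complex.I * v) = j.inChart z (h w) (fderiv ℝ h w v)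

end InChart

/-- A linear complex structure on the plane is conjugate to multiplication by `I` on `ℂ`. -/
theorem exists_continuousLinearEquiv_I_mul (J : Plane →L[ℝ] Plane) (hJ : ∀ v, J (J v) = -v) :
    ∃ Λ : ℂ ≃L[ℝ] Plane, ∀ w, Λ (Complex.I * w) = J (Λ w) := by
  obtain ⟨v, hv⟩ : ∃ v : Plane, v ≠ 0 := exists_ne 0
  let L : ℂ →L[ℝ] Plane :=
    Complex.reCLM.smulRight v + Complex.imCLM.smulRight (J v)
  have hL : ∀ w, L w = w.re • v + w.im • J v := fun w ↦ rfl
  have hLI : ∀ w, L (Complex.I * w) = J (L w) := by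
    intro w
    simp only [hL, map_add, map_smul, hJ]
    simp
    abel
  have hinj : Function.Injective L := by
    refine (injective_iff_map_eq_zero L).2 fun w hw ↦ ?_
    have h1 : J (L w) = 0 := by rw [hw, map_zero]
    rw [hL] at hw h1
    rw [map_add, map_smul, map_smul, hJ] at h1
    -- Combining `L w = 0` with `J (L w) = 0` eliminates `J v`.
    have h2 : (w.re ^ 2 + w.im ^ 2) • v = 0 := by
      have : (w.re ^ 2 + w.im ^ 2) • v =
          w.re • (w.re • v + w.im • J v) - w.im • (w.re • J v + w.im • -v) := by
        module
      rw [this, hw, h1, smul_zero, smul_zero, sub_zero]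
    have h3 := (smul_eq_zero.1 h2).resolve_right hv
    apply Complex.ext <;> simp <;> nlinarith [sq_nonneg w.re, sq_nonneg w.im]
  refine ⟨(L.toLinearMap.linearEquivOfInjective hinj
    (by simp [Complex.finrank_real_complex])).toContinuousLinearEquiv, hLI⟩

/-! ### Convergent disks around an interior point, and the theorem. -/

section InChart

variable {S : Type*} [TopologicalSpace S] [ChartedSpace (EuclideanHalfSpace 2) S]
  [IsManifold (𝓡∂ 2) ∞ S]

/-- The affine coordinate `w ↦ p + Λ w`, with `Λ` intertwining `i` and the limit structure at `p`,
normalizes the latter to `i` at the origin, as `exists_isHolomorphicDisk_tendsto` requires. -/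
theorem exists_eventually_isChartDisk {jn : ℕ → SurfaceComplexStructure S}
    {j : SurfaceComplexStructure S} (hj : TendstoSmooth jn j) {z : S}
    (hz : z ∈ (𝓡∂ 2).interior S) :
    ∃ (hn : ℕ → ℂ ≃ₜ Plane) (h : ℂ ≃ₜ Plane),
      (∀ᶠ n in atTop, IsChartDisk (jn n) z (hn n)) ∧ IsChartDisk j z h ∧
        ∀ N w, CTendstoAt N atTop (fun n ↦ hn n) h w := by
  set p := extChartAt (𝓡∂ 2) z z with hp
  set V := interior (extChartAt (𝓡∂ 2) z).target with hV
  have hpV : p ∈ V := ModelWithCorners.isInteriorPoint_iff.1 hz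
  obtain ⟨Λ, hΛ⟩ := exists_continuousLinearEquiv_I_mul (j.inChart z p)
    (j.inChart_inChart (interior_subset hpV))
  obtain ⟨a, ha⟩ : ∃ a : ℂ ≃ₜ Plane, ∀ w, a w = p + Λ w :=
    ⟨Λ.toHomeomorph.trans (Homeomorph.addLeft p), fun _ ↦ rfl⟩
  have has : ∀ y, a.symm y = Λ.symm (y - p) := fun y ↦ by
    rw [Homeomorph.symm_apply_eq, ha]; simp
  have hae : ⇑a = fun w ↦ p + Λ w := funext ha
  have hac : ContDiff ℝ ∞ a := by
    rw [hae]; exact contDiff_const.add Λ.contDiff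
  have hasc : ContDiff ℝ ∞ a.symm := by
    rw [show ⇑a.symm = fun y ↦ Λ.symm (y - p) from funext has]
    exact Λ.symm.contDiff.comp (contDiff_id.sub contDiff_const)
  have had : ∀ w, HasFDerivAt a (Λ : ℂ →L[ℝ] Plane) w := fun w ↦ by
    rw [hae]; exact Λ.hasFDerivAt.const_add p
  obtain ⟨R, hR, hRV⟩ : ∃ R > 0, ∀ x, ‖x‖ < R → a x ∈ V := by
    have h0 : a 0 ∈ V := by rwa [ha, map_zero, add_zero]
    have : a ⁻¹' V ∈ 𝓝 (0 : ℂ) :=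
      a.continuous.continuousAt.preimage_mem_nhds (isOpen_interior.mem_nhds h0)
    obtain ⟨R, hR, h⟩ := Metric.mem_nhds_iff.1 this
    exact ⟨R, hR, fun x hx ↦ h (by simpa using hx)⟩
  let C : (Plane →L[ℝ] Plane) → ℂ →L[ℝ] ℂ := fun A ↦
    (Λ.symm : Plane →L[ℝ] ℂ) ∘L A ∘L (Λ : ℂ →L[ℝ] Plane)
  have hC : ContDiff ℝ ∞ C :=
    contDiff_const.clm_comp (contDiff_id.clm_comp contDiff_const)
  have hCC : ∀ A v, C A v = Λ.symm (A (Λ v)) := fun _ _ ↦ rfl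
  let T : SurfaceComplexStructure S → ℂ → ℂ →L[ℝ] ℂ := fun j' ↦ C ∘ j'.inChart z ∘ a
  have hTv : ∀ j' x v, T j' x v = Λ.symm (j'.inChart z (a x) (Λ v)) := fun _ _ _ ↦ rfl
  have hTc : ∀ j' x, ‖x‖ < R → ContDiffAt ℝ ∞ (T j') x := fun j' x hx ↦
    hC.contDiffAt.comp x ((j'.contDiffAt_inChart (hRV x hx)).comp x hac.contDiffAt)
  have hTT : ∀ j' x, ‖x‖ < R → ∀ v, T j' x (T j' x v) = -v := fun j' x hx v ↦ by
    rw [hTv, hTv, Λ.apply_symm_apply, j'.inChart_inChart (interior_subset (hRV x hx)), map_neg,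
      Λ.symm_apply_apply]
  have hlim : ∀ (N : ℕ) x, ‖x‖ < R → CTendstoAt N atTop (fun n ↦ T (jn n)) (T j) x := by
    intro N x hx
    have hle : ((N : ℕ∞) : WithTop ℕ∞) ≤ ∞ := by exact_mod_cast le_top
    exact .comp_left (hC.contDiffAt.of_le hle)
      ((hj.cTendstoAt z (hRV x hx) N).comp (.const (hac.contDiffAt.of_le hle)))
  obtain ⟨gn, g, hgn, hg, hgg⟩ := exists_isHolomorphicDisk_tendsto hR
    (fun n ↦ hTc (jn n)) (hTc j) (fun n ↦ hTT (jn n)) (hTT j) hlim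
    (fun v ↦ by rw [hTv, ha, map_zero, add_zero, ← hΛ, Λ.symm_apply_apply])
  have key : ∀ {j' : SurfaceComplexStructure S} {f : ℂ ≃ₜ ℂ},
      IsHolomorphicDisk R (T j') f → IsChartDisk j' z (f.trans a) := by
    intro j' f hf
    refine ⟨?_, fun w hw ↦ hRV _ (hf.mapsTo w (by simpa using hw)), hac.comp hf.contDiff,
      hf.contDiff_symm.comp hasc, fun w hw v ↦ ?_⟩
    · rw [Homeomorph.trans_apply, hf.map_zero, ha, map_zero, add_zero]
    · have hd : fderiv ℝ (f.trans a) w = (Λ : ℂ →L[ℝ] Plane) ∘L fderiv ℝ f w :=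
        ((had (f w)).comp w (hf.contDiff.differentiable (by simp) w).hasFDerivAt).fderiv
      have h1 := hf.fderiv_I_mul w (by simpa using hw) v
      rw [hTv] at h1
      rw [hd, ContinuousLinearMap.comp_apply, ContinuousLinearMap.comp_apply, h1]
      exact Λ.apply_symm_apply _
  refine ⟨fun n ↦ (gn n).trans a, g.trans a, hgn.mono fun n hn ↦ key hn, key hg, fun N w ↦ ?_⟩
  have hle : ((N : ℕ∞) : WithTop ℕ∞) ≤ ∞ := by exact_mod_cast le_top
  exact CTendstoAt.comp_left (hac.contDiffAt.of_le hle) (hgg N w)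

/-- For an index where the convergent family gives no disk, the constant sequence `jn n` provides
one; only finitely many terms change, so the limit is unaffected. -/
theorem exists_isChartDisk_tendsto {jn : ℕ → SurfaceComplexStructure S}
    {j : SurfaceComplexStructure S} (hj : TendstoSmooth jn j) {z : S}
    (hz : z ∈ (𝓡∂ 2).interior S) :
    ∃ (hn : ℕ → ℂ ≃ₜ Plane) (h : ℂ ≃ₜ Plane),
      (∀ n, IsChartDisk (jn n) z (hn n)) ∧ IsChartDisk j z h ∧
        ∀ N w, CTendstoAt N atTop (fun n ↦ hn n) h w := by
  classical
  obtain ⟨hn, h, hev, hh, hlim⟩ := exists_eventually_isChartDisk hj hz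
  have hex : ∀ n, ∃ f, IsChartDisk (jn n) z f := fun n ↦
    let ⟨_, f, _, hf, _⟩ := exists_eventually_isChartDisk (tendstoSmooth_const (jn n)) hz
    ⟨f, hf⟩
  choose f hf using hex
  refine ⟨fun n ↦ if IsChartDisk (jn n) z (hn n) then hn n else f n, h, fun n ↦ ?_, hh,
    fun N w ↦ (hlim N w).congr ?_ .rfl⟩
  · dsimp only
    split_ifs with hc
    exacts [hc, hf n]
  · filter_upwards [tendsto_fst.eventually hev] with q hq
    rw [if_pos hq]

end InChart

theorem mainTheorem6 {S : Type*} [TopologicalSpace S] [T2Space S] [CompactSpace S]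
    [ChartedSpace (EuclideanHalfSpace 2) S] [IsManifold (𝓡∂ 2) ∞ S]
    (jn : ℕ → SurfaceComplexStructure S) (j : SurfaceComplexStructure S)
    (hj : TendstoSmooth jn j) (z : S) (hz : z ∈ (𝓡∂ 2).interior S) :
    ∃ (Un : ℕ → Set S) (U : Set S)
      (ψn : ℕ → OpenPartialHomeomorph ℂ S) (ψ : OpenPartialHomeomorph ℂ S),
      (∀ n, IsOpen (Un n) ∧ z ∈ Un n ∧ (ψn n).target = Un n) ∧
      (IsOpen U ∧ z ∈ U ∧ ψ.target = U) ∧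
      (∀ n, IsDiskBiholomorphism (jn n) (ψn n)) ∧
      IsDiskBiholomorphism j ψ ∧
      TendstoSmoothLoc (fun n ↦ ψn n) ψ (Metric.ball 0 1) ∧
      (∀ n, ψn n 0 = z) ∧ ψ 0 = z := by
  obtain ⟨hn, h, hhn, hh, hlim⟩ := exists_isChartDisk_tendsto hj hz
  have hzero : ∀ {j' : SurfaceComplexStructure S} {f : ℂ ≃ₜ Plane} (hf : IsChartDisk j' z f),
      chartDisk z f hf.mapsTo 0 = z := fun {j' f} hf ↦
    (congrArg _ hf.map_zero).trans (extChartAt_to_inv z)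
  have hmem : ∀ {j' : SurfaceComplexStructure S} {f : ℂ ≃ₜ Plane} (hf : IsChartDisk j' z f),
      z ∈ (chartDisk z f hf.mapsTo).target := fun {j' f} hf ↦ by
    have := (chartDisk z f hf.mapsTo).map_source (x := 0) (Metric.mem_ball_self one_pos)
    rwa [hzero hf] at this
  exact ⟨_, _, fun n ↦ chartDisk z (hn n) (hhn n).mapsTo, chartDisk z h hh.mapsTo,
    fun n ↦ ⟨OpenPartialHomeomorph.open_target _, hmem (hhn n), rfl⟩,
    ⟨OpenPartialHomeomorph.open_target _, hmem hh, rfl⟩,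
    fun n ↦ isDiskBiholomorphism_chartDisk _ _ (hhn n).contDiff (hhn n).contDiff_symm
      (hhn n).fderiv_I_mul,
    isDiskBiholomorphism_chartDisk _ _ hh.contDiff hh.contDiff_symm hh.fderiv_I_mul,
    tendstoSmoothLoc_of_cTendstoAt Metric.isOpen_ball z hh.mapsTo (fun N w _ ↦ hlim N w)
      (.of_forall fun _ _ _ ↦ rfl) fun _ _ ↦ rfl,
    fun n ↦ hzero (hhn n), hzero hh⟩
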